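/- Let $\rho$ be Dickman's function: $\rho(u)=0$ for $u<0$, $\rho(u)=1$ for $0\le u\le 1$, $\rho$ is continuous on $[0,\infty)$, and $u\rho'(u)=-\rho(u-1)$ for $u>1$; $\rho'$ is understood as the right derivative (thus it is right-continuous at $0$ and $1$). Let $\omega$ be Buchstab's function: $\omega(u)=0$ for $u<1$, $\omega(u)=1/u$ for $1\le u\le 2$, $\omega$ is continuous on $[1,\infty)$, and $(u\,\omega(u))'=\omega(u-1)$ for $u>2$. Let $\gamma$ be Euler's constant and $\{t\}$ the fractional part of $t$. Let $\mathcal S_y$ be the set of $y$-smooth numbers, i.e. positive integers all of whose prime factors are at most $y$. For $x>0$ and $y\ge 2$ put $u=\frac{\log x}{\log y}$, $$\Psi(x,y)=|\mathcal S_y\cap[1,x]|,\qquad \Phi(x,y)=|\{1\le n\le x:\ p\mid n\Rightarrow p>y\}|,$$ $$\Pi(y)=\prod_{p\le y}\Bigl(1-\frac1p\Bigr),\qquad \mu_y(u)=\int_0^u\omega(u-v)\,y^{-v}\,dv,$$ $$V(x,y)=1_{x\ge1}+x\Bigl(\Pi(y)-\frac{e^{-\gamma}}{\log y}+\mu_y(u)\Bigr),\qquad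 V^*(x,y)=1_{x\ge 1}+x\,\mu_y(u),$$ $$Q=V-\Phi,\quad Q^*=V^*-\Phi,\qquad R(x,y)=\sum_{n\in\mathcal S_y}Q(x/n,y),\quad R^*(x,y)=\sum_{n\in\mathcal S_y}Q^*(x/n,y),$$ and, for $x\ge1$, $$\Lambda(x,y)=x\rho(u)-\{x\}-x\int_0^u\rho'(u-v)\frac{\{y^v\}}{y^v}\,dv,\qquad \Delta(x,y)=\Psi(x,y)-\Lambda(x,y).$$ Theorem. Let $x\ge 1$, $y\ge 2$ and $u=\frac{\log x}{\log y}$. The series defining $R(t,y)$ and $R^*(t,y)$ converge absolutely for every $t>0$, the following integrals converge absolutely, and $$\Delta(x,y)=R(x,y)+x\int_{-\infty}^u\frac{R(y^v,y)}{y^v}\,\rho'(u-v)\,dv,$$ $$\Delta(x,y)=R^*(x,y)+x\int_0^u\frac{R^*(y^v,y)}{y^v}\,\rho'(u-v)\,dv,$$ $$R(x,y)=\Delta(x,y)+x\int_0^\infty\frac{\Delta(y^v,y)}{y^v}\,\bigl(\omega(u-v)-e^{-\gamma}\bigr)\,dv,$$ $$R^*(x,y)=\Delta(x,y)+x\int_0^u\frac{\Delta(y^v,y)}{y^v}\,\omega(u-v)\,dv.$$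 -/

import Mathlib

open MeasureTheory

noncomputable section

namespace SmoothRough

/-- Successive approximations to Dickman's function by the integrated delay equation
`ρ(u) = 1 - ∫_1^u ρ(t-1)/t dt` for `u ≥ 1`. The `k`-th one equals `ρ` on `(-∞, k+1]`. -/
def dickmanApprox : ℕ → ℝ → ℝ
  | 0, u => if u < 0 then 0 else 1
  | k + 1, u =>
      if u < 0 then 0
      else if u ≤ 1 then 1
      else 1 - ∫ t in (1 : ℝ)..u, dickmanApprox k (t - 1) / t

/-- Dickman's function: `ρ = 0` on `(-∞, 0)`, `ρ = 1` on `[0, 1]`, `ρ` is continuous on `[0, ∞)`,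
and `u ρ'(u) = -ρ(u-1)` for `u > 1`. -/
def dickman (u : ℝ) : ℝ := dickmanApprox ⌊u⌋₊ u

/-- The derivative of Dickman's function, as a right derivative at every point (so that it is
right-continuous at `0` and at `1`). -/
def dickmanDeriv (u : ℝ) : ℝ := derivWithin dickman (Set.Ici u) u

/-- Successive approximations to Buchstab's function by the integrated delay equation
`u ω(u) = 1 + ∫_1^{u-1} ω(t) dt` for `u ≥ 2`. The `k`-th one equals `ω` on `(-∞, k+1)`. -/
def buchstabApprox : ℕ → ℝ → ℝ
  | 0, _ => 0
  | k + 1, u =>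
      if u < 1 then 0
      else if u ≤ 2 then 1 / u
      else (1 + ∫ t in (1 : ℝ)..(u - 1), buchstabApprox k t) / u

/-- Buchstab's function: `ω = 0` on `(-∞, 1)`, `ω(u) = 1/u` on `[1, 2]`, `ω` is continuous on
`[1, ∞)`, and `(u ω(u))' = ω(u-1)` for `u > 2`. -/
def buchstab (u : ℝ) : ℝ := buchstabApprox ⌊u⌋₊ u

/-- The `y`-smooth positive integers: all prime factors are at most `y`. -/
def smooth (y : ℝ) : Set ℕ := {n | n ≠ 0 ∧ ∀ p : ℕ, p.Prime → p ∣ n → (p : ℝ) ≤ y}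

/-- The `y`-rough positive integers: all prime factors are greater than `y`. -/
def rough (y : ℝ) : Set ℕ := {n | n ≠ 0 ∧ ∀ p : ℕ, p.Prime → p ∣ n → y < (p : ℝ)}

open scoped Classical in
/-- `Ψ(x, y)`, the number of `y`-smooth integers in `[1, x]`. -/
def Psi (x y : ℝ) : ℝ := (((Finset.Icc 1 ⌊x⌋₊).filter (fun n => n ∈ smooth y)).card : ℝ)

open scoped Classical in
/-- `Φ(x, y)`, the number of `y`-rough integers in `[1, x]`. -/
def Phi (x y : ℝ) : ℝ := (((Finset.Icc 1 ⌊x⌋₊).filter (fun n => n ∈ rough y)).card : ℝ)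

/-- De Bruijn's approximation `Λ(x, y)` to `Ψ(x, y)`, for `x ≥ 1` and `y ≥ 2`. -/
def Lam (x y : ℝ) : ℝ :=
  x * dickman (Real.log x / Real.log y) - Int.fract x
    - x * ∫ v in (0 : ℝ)..(Real.log x / Real.log y),
        dickmanDeriv (Real.log x / Real.log y - v) * (Int.fract (y ^ v) / y ^ v)

/-- `μ_y(u) = ∫_0^u ω(u-v) y^{-v} dv`. -/
def muFun (y u : ℝ) : ℝ := ∫ v in (0 : ℝ)..u, buchstab (u - v) * y ^ (-v)

/-- `Π(y) = ∏_{p ≤ y} (1 - 1/p)`. -/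
def primeProd (y : ℝ) : ℝ :=
  ∏ p ∈ (Finset.Icc 1 ⌊y⌋₊).filter Nat.Prime, (1 - 1 / (p : ℝ))

/-- `V(x, y)`. -/
def V (x y : ℝ) : ℝ :=
  (if 1 ≤ x then 1 else 0) +
    x * (primeProd y - Real.exp (-Real.eulerMascheroniConstant) / Real.log y
      + muFun y (Real.log x / Real.log y))

/-- `V*(x, y)`. -/
def VStar (x y : ℝ) : ℝ :=
  (if 1 ≤ x then 1 else 0) + x * muFun y (Real.log x / Real.log y)

/-- `Δ(x, y) = Ψ(x, y) - Λ(x, y)`. -/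
def Delta (x y : ℝ) : ℝ := Psi x y - Lam x y

/-- `Q(x, y) = V(x, y) - Φ(x, y)`. -/
def Q (x y : ℝ) : ℝ := V x y - Phi x y

/-- `Q*(x, y) = V*(x, y) - Φ(x, y)`. -/
def QStar (x y : ℝ) : ℝ := VStar x y - Phi x y

/-- `R(x, y)`, the sum of `Q(x/n, y)` over all `y`-smooth `n`. -/
def R (x y : ℝ) : ℝ := ∑' n : smooth y, Q (x / ((n : ℕ) : ℝ)) y

/-- `R*(x, y)`, the sum of `Q*(x/n, y)` over all `y`-smooth `n`. -/
def RStar (x y : ℝ) : ℝ := ∑' n : smooth y, QStar (x / ((n : ℕ) : ℝ)) y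

end SmoothRough

end

open SmoothRough

open scoped Convolution
open Set Filter Topology

namespace SmoothRough

/-! On the scale x = y^u, with every quantity divided by y^u, the theorem is an identity in a
convolution algebra. Write ψ, λ, r for the normalized Ψ, Λ, R*, put d = ψ - λ, let H be the
indicator of [0, ∞), and let f be the normalized fractional part. Formally adjoin the unit δ.

Three facts suffice for the starred identities. First, δ + ρ' and δ + ω are inverse to each other
(`dickmanDeriv_conv_buchstab`): multiplication by u is a derivation of convolution, and the two
delay equations say that it sends them to -T * (δ + ρ') and T * (δ + ω), with T = H(· - 1). Second,
ρ = (δ + ρ') * H gives λ = (δ + ρ') * (H - f), hence (δ + ω) * λ = H - f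
(`lamNorm_add_conv_buchstab`). Third, each integer is uniquely a smooth number times a rough one,
which gives r = (δ + ω) * ψ - (H - f) (`rStarNorm_eq`). Therefore r = (δ + ω) * d, and inverting, d
= (δ + ρ') * r.

For R, the Euler product gives R(t) = R*(t) + ct with c = 1 - e^{-γ} / (Π(y) log y). Since ∫ρ' = -1,
extending the integral to -∞ cancels the constant c. In the other direction one needs e^{-γ} ∫d =
-c, that is, ∫ψ = 1 / (Π(y) log y) and ∫λ = ∫ρ = e^γ. The last value (`integral_dickman`) comes from
the Laplace transform L of ρ: uρ(u) is the integral of ρ over [u - 1, u], so L(s) exp(Ein(s)) is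
constant, and its value is read off as s → ∞. -/

/-- Measurable functions on `ℝ` that vanish on the negative axis and are bounded on every left
half-line. They are closed under convolution. -/
structure Causal (f : ℝ → ℝ) : Prop where
  measurable : Measurable f
  zero : ∀ u < 0, f u = 0
  bdd : ∀ a, ∃ C, ∀ u ≤ a, |f u| ≤ C

/-- Convolution of real functions on the line. -/
noncomputable abbrev conv (f g : ℝ → ℝ) : ℝ → ℝ := f ⋆[ContinuousLinearMap.mul ℝ ℝ, volume] g

theorem conv_apply (f g : ℝ → ℝ) (u : ℝ) : conv f g u = ∫ v, f v * g (u - v) := rfl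

theorem conv_comm (f g : ℝ → ℝ) : conv f g = conv g f := by
  ext u
  rw [conv_apply, conv_apply, ← integral_sub_left_eq_self _ volume u]
  simp [mul_comm]

/-! ### The convolution algebra of causal functions -/

namespace Causal

variable {f g k : ℝ → ℝ}

theorem abs (hf : Causal f) : Causal (fun u => |f u|) :=
  ⟨hf.measurable.abs, fun u hu => by simp [hf.zero u hu], fun a => by simpa using hf.bdd a⟩

theorem add (hf : Causal f) (hg : Causal g) : Causal (f + g) := by
  refine ⟨hf.measurable.add hg.measurable, fun u hu => by simp [hf.zero u hu, hg.zero u hu],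
    fun a => ?_⟩
  obtain ⟨C, hC⟩ := hf.bdd a
  obtain ⟨D, hD⟩ := hg.bdd a
  exact ⟨C + D, fun u hu => (abs_add_le _ _).trans (add_le_add (hC u hu) (hD u hu))⟩

theorem neg (hf : Causal f) : Causal (-f) :=
  ⟨hf.measurable.neg, fun u hu => by simp [hf.zero u hu], fun a => by simpa using hf.bdd a⟩

theorem sub (hf : Causal f) (hg : Causal g) : Causal (f - g) := by
  rw [sub_eq_add_neg]; exact hf.add hg.neg

theorem id_mul (hf : Causal f) : Causal (fun u => u * f u) := by
  refine ⟨measurable_id.mul hf.measurable, fun u hu => by simp [hf.zero u hu], fun a => ?_⟩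
  obtain ⟨C, hC⟩ := hf.bdd a
  refine ⟨|a| * C, fun u hu => ?_⟩
  rcases lt_or_ge u 0 with h | h
  · rw [hf.zero u h, mul_zero, abs_zero]
    exact mul_nonneg (abs_nonneg _) ((abs_nonneg _).trans (hC u hu))
  · rw [abs_mul]
    exact mul_le_mul (abs_le_abs_of_nonneg h hu) (hC u hu) (abs_nonneg _) (abs_nonneg _)

/-- The integrand of a convolution of causal functions is bounded, with support in `[0, u]`. -/
theorem integrand_eq_indicator (hf : Causal f) (hg : Causal g) (u : ℝ) :
    (fun v => f v * g (u - v)) = (Icc 0 u).indicator (fun v => f v * g (u - v)) := by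
  ext v
  by_cases hv : v ∈ Icc 0 u
  · rw [indicator_of_mem hv]
  · rw [indicator_of_notMem hv]
    rw [mem_Icc, not_and_or, not_le, not_le] at hv
    rcases hv with h | h
    · rw [hf.zero v h, zero_mul]
    · rw [hg.zero _ (by linarith), mul_zero]

theorem exists_integrand_bound (hf : Causal f) (hg : Causal g) (a : ℝ) :
    ∃ C, 0 ≤ C ∧ ∀ u ≤ a, ∀ v ∈ Icc 0 u, ‖f v * g (u - v)‖ ≤ C := by
  obtain ⟨C, hC⟩ := hf.bdd a
  obtain ⟨D, hD⟩ := hg.bdd a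
  have h0 : 0 ≤ C := (abs_nonneg _).trans (hC a le_rfl)
  have h1 : 0 ≤ D := (abs_nonneg _).trans (hD a le_rfl)
  refine ⟨C * D, mul_nonneg h0 h1, fun u hu v hv => ?_⟩
  rw [norm_mul]
  exact mul_le_mul (hC v (hv.2.trans hu)) (hD _ (by linarith [hv.1])) (norm_nonneg _) h0

theorem integrable (hf : Causal f) (hg : Causal g) (u : ℝ) :
    Integrable (fun v => f v * g (u - v)) := by
  rw [hf.integrand_eq_indicator hg u, integrable_indicator_iff measurableSet_Icc]
  obtain ⟨C, -, hC⟩ := hf.exists_integrand_bound hg u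
  refine Measure.integrableOn_of_bounded (M := C) (by simp) ?_ ?_
  · exact (hf.measurable.mul
      (hg.measurable.comp (measurable_const.sub measurable_id))).aestronglyMeasurable
  · exact (ae_restrict_iff' measurableSet_Icc).2 (Eventually.of_forall fun v hv => hC u le_rfl v hv)

theorem conv (hf : Causal f) (hg : Causal g) : Causal (conv f g) := by
  refine ⟨?_, fun u hu => ?_, fun a => ?_⟩
  · have : Measurable (fun p : ℝ × ℝ => f p.2 * g (p.1 - p.2)) :=
      (hf.measurable.comp measurable_snd).mul
        (hg.measurable.comp (measurable_fst.sub measurable_snd))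
    exact this.stronglyMeasurable.integral_prod_right.measurable
  · rw [conv_apply, hf.integrand_eq_indicator hg u, Icc_eq_empty (by linarith)]
    simp
  · obtain ⟨C, h0, hC⟩ := hf.exists_integrand_bound hg a
    refine ⟨C * |a|, fun u hu => ?_⟩
    rw [conv_apply, hf.integrand_eq_indicator hg u, integral_indicator measurableSet_Icc]
    refine (norm_setIntegral_le_of_norm_le_const (by simp) (hC u hu)).trans ?_
    rw [Real.volume_real_Icc]
    gcongr
    exact max_le (by linarith [le_abs_self a]) (abs_nonneg a)

theorem conv_add (hf : Causal f) (hg : Causal g) (hk : Causal k) :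
    SmoothRough.conv f (g + k) = SmoothRough.conv f g + SmoothRough.conv f k := by
  ext u
  simp only [Pi.add_apply, conv_apply, mul_add]
  exact integral_add (hf.integrable hg u) (hf.integrable hk u)

theorem add_conv (hf : Causal f) (hg : Causal g) (hk : Causal k) :
    SmoothRough.conv (f + g) k = SmoothRough.conv f k + SmoothRough.conv g k := by
  rw [conv_comm, hk.conv_add hf hg, conv_comm k f, conv_comm k g]

/-- All integrability conditions hold at every point, because each convolution integrand is bounded
with support in a compact interval. -/
theorem conv_assoc (hf : Causal f) (hg : Causal g) (hk : Causal k) :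
    SmoothRough.conv (SmoothRough.conv f g) k = SmoothRough.conv f (SmoothRough.conv g k) := by
  ext u
  refine convolution_assoc _ _ _ _ (fun x y z => mul_assoc x y z)
    hf.measurable.aestronglyMeasurable hg.measurable.aestronglyMeasurable
    hk.measurable.aestronglyMeasurable ?_ ?_ ?_
  · exact Eventually.of_forall fun x => hf.integrable hg x
  · exact Eventually.of_forall fun x => hg.abs.integrable hk.abs x
  · exact hf.abs.integrable (hg.abs.conv hk.abs) u

/-- Multiplication by the variable is a derivation for the convolution. -/
theorem mul_conv (hf : Causal f) (hg : Causal g) (u : ℝ) :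
    u * SmoothRough.conv f g u =
      SmoothRough.conv (fun v => v * f v) g u + SmoothRough.conv f (fun v => v * g v) u := by
  simp only [conv_apply]
  rw [← integral_const_mul, ← integral_add (hf.id_mul.integrable hg u) (hf.integrable hg.id_mul u)]
  congr 1; ext v; ring

/-- The convolution of causal functions as an interval integral. -/
theorem conv_eq_intervalIntegral (hf : Causal f) (hg : Causal g) {u : ℝ} (hu : 0 ≤ u) :
    SmoothRough.conv f g u = ∫ v in (0 : ℝ)..u, f v * g (u - v) := by
  rw [conv_apply, hf.integrand_eq_indicator hg u, integral_indicator measurableSet_Icc,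
    integral_Icc_eq_integral_Ioc, intervalIntegral.integral_of_le hu]
  refine setIntegral_congr_fun measurableSet_Ioc fun v hv => ?_
  rw [indicator_of_mem (Ioc_subset_Icc_self hv)]

end Causal

theorem neg_conv (f g : ℝ → ℝ) : conv (-f) g = -conv f g := by
  ext u; simp [conv_apply, integral_neg]

theorem conv_neg (f g : ℝ → ℝ) : conv f (-g) = -conv f g := by
  ext u; simp [conv_apply, integral_neg]

/-! ### The Heaviside function, translations and primitives -/

/-- The indicator function of `[0, ∞)`. -/
noncomputable def heaviside : ℝ → ℝ := (Ici (0 : ℝ)).indicator 1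

theorem heaviside_of_nonneg {u : ℝ} (hu : 0 ≤ u) : heaviside u = 1 := by simp [heaviside, hu]

theorem heaviside_of_neg {u : ℝ} (hu : u < 0) : heaviside u = 0 := by simp [heaviside, hu]

theorem causal_heaviside : Causal heaviside := by
  refine ⟨measurable_one.indicator measurableSet_Ici, fun u hu => heaviside_of_neg hu,
    fun a => ⟨1, fun u _ => ?_⟩⟩
  rcases lt_or_ge u 0 with h | h
  · simp [heaviside_of_neg h]
  · simp [heaviside_of_nonneg h]

theorem Causal.shift {f : ℝ → ℝ} (hf : Causal f) {a : ℝ} (ha : 0 ≤ a) :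
    Causal (fun u => f (u - a)) := by
  refine ⟨hf.measurable.comp (measurable_id.sub_const a), fun u hu => hf.zero _ (by linarith),
    fun b => ?_⟩
  obtain ⟨C, hC⟩ := hf.bdd (b - a)
  exact ⟨C, fun u hu => hC _ (by linarith)⟩

theorem conv_shift (f g : ℝ → ℝ) (a u : ℝ) :
    conv f (fun v => g (v - a)) u = conv f g (u - a) := by
  simp only [conv_apply, sub_right_comm]

theorem shift_conv (f g : ℝ → ℝ) (a u : ℝ) :
    conv (fun v => f (v - a)) g u = conv f g (u - a) := by
  rw [conv_comm, conv_shift, conv_comm]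

theorem Causal.conv_heaviside {f : ℝ → ℝ} (hf : Causal f) {u : ℝ} (hu : 0 ≤ u) :
    SmoothRough.conv f heaviside u = ∫ v in (0 : ℝ)..u, f v := by
  rw [hf.conv_eq_intervalIntegral causal_heaviside hu]
  refine intervalIntegral.integral_congr fun v hv => ?_
  rw [uIcc_of_le hu] at hv
  simp only [heaviside_of_nonneg (sub_nonneg.2 hv.2), mul_one]

theorem Causal.intervalIntegrable {f : ℝ → ℝ} (hf : Causal f) (a b : ℝ) :
    IntervalIntegrable f volume a b := by
  obtain ⟨C, hC⟩ := hf.bdd (max a b)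
  rw [intervalIntegrable_iff]
  refine Measure.integrableOn_of_bounded (M := C) (by simp) hf.measurable.aestronglyMeasurable ?_
  refine (ae_restrict_iff' measurableSet_uIoc).2 (Eventually.of_forall fun v hv => hC v ?_)
  rw [uIoc] at hv
  exact hv.2

/-! ### Dickman's function -/

/-- Truncating the upper limit at 1 merges the branches u ≤ 1 and u > 1 into a single formula, from
which continuity is visible. -/
theorem dickmanApprox_succ_of_nonneg (k : ℕ) {u : ℝ} (hu : 0 ≤ u) :
    dickmanApprox (k + 1) u = 1 - ∫ t in (1 : ℝ)..max u 1, dickmanApprox k (t - 1) / t := by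
  rw [dickmanApprox, if_neg hu.not_gt]
  split_ifs with h
  · simp [max_eq_right h]
  · rw [max_eq_left (not_le.1 h).le]

/-- The delay is one unit, so agreement of two consecutive approximations below k + 1 propagates to
agreement of the next two below k + 2. -/
theorem dickmanApprox_succ_eq (k : ℕ) :
    ∀ u : ℝ, u < k + 1 → dickmanApprox (k + 1) u = dickmanApprox k u := by
  induction k with
  | zero =>
    intro u hu
    simp only [Nat.cast_zero, zero_add] at hu
    simp [dickmanApprox, hu.le]
  | succ k ih =>
    intro u hu
    rcases lt_or_ge u 0 with h | h
    · simp [dickmanApprox, h]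
    · rw [dickmanApprox_succ_of_nonneg _ h, dickmanApprox_succ_of_nonneg _ h]
      congr 1
      refine intervalIntegral.integral_congr fun t ht => ?_
      rw [uIcc_of_le (le_max_right _ _)] at ht
      rw [ih]
      push_cast at hu
      have := ht.2
      have hk : (0 : ℝ) ≤ k := k.cast_nonneg
      rcases le_max_iff.1 this with h | h <;> linarith

theorem dickmanApprox_eq_dickman {k : ℕ} {u : ℝ} (hu : u < k + 1) :
    dickmanApprox k u = dickman u := by
  have hk : ⌊u⌋₊ ≤ k := by
    rcases lt_or_ge u 0 with h | h
    · simp [Nat.floor_of_nonpos h.le]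
    · exact Nat.lt_succ_iff.1 ((Nat.floor_lt h).2 (by exact_mod_cast hu))
  have h1 := Nat.lt_floor_add_one u
  rw [dickman]
  induction k, hk using Nat.le_induction with
  | base => rfl
  | succ n hn ih =>
    have h2 : u < n + 1 := h1.trans_le (by exact_mod_cast Nat.succ_le_succ hn)
    rw [dickmanApprox_succ_eq n u h2, ih h2]

theorem dickman_of_neg {u : ℝ} (hu : u < 0) : dickman u = 0 := by
  rw [← dickmanApprox_eq_dickman (k := 0) (by simpa using hu.trans one_pos)]
  simp [dickmanApprox, hu]

theorem dickman_of_le_one {u : ℝ} (h0 : 0 ≤ u) (h1 : u ≤ 1) : dickman u = 1 := by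
  rw [← dickmanApprox_eq_dickman (k := 1) (by push_cast; linarith)]
  simp [dickmanApprox, h0.not_gt, h1]

theorem dickman_eq_one_sub_integral {u : ℝ} (hu : 0 ≤ u) :
    dickman u = 1 - ∫ t in (1 : ℝ)..max u 1, dickman (t - 1) / t := by
  have h1 := Nat.lt_floor_add_one u
  rw [← dickmanApprox_eq_dickman (k := ⌊u⌋₊ + 1) (by push_cast; linarith),
    dickmanApprox_succ_of_nonneg _ hu]
  congr 1
  refine intervalIntegral.integral_congr fun t ht => ?_
  rw [uIcc_of_le (le_max_right _ _)] at ht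
  rw [dickmanApprox_eq_dickman]
  rcases le_max_iff.1 ht.2 with h | h
  · linarith
  · have : (0 : ℝ) ≤ ⌊u⌋₊ := Nat.cast_nonneg _
    linarith

/-- The truncations change nothing for t ≥ 1 but make the integrand continuous on the whole line, so
the fundamental theorem of calculus applies at u = 1 too. -/
theorem continuous_delayed_quotient {f : ℝ → ℝ} (hf : ContinuousOn f (Ici 0)) :
    Continuous (fun t => f (max (t - 1) 0) / max t 1) := by
  have h : Continuous (fun t : ℝ => f (max (t - 1) 0)) :=
    hf.comp_continuous (by fun_prop) fun t => mem_Ici.2 (le_max_right _ _)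
  exact h.div (by fun_prop) fun t => (one_pos.trans_le (le_max_right _ _)).ne'

theorem delayed_quotient_integral (f : ℝ → ℝ) {u : ℝ} (hu : 1 ≤ u) :
    ∫ t in (1 : ℝ)..u, f (t - 1) / t = ∫ t in (1 : ℝ)..u, f (max (t - 1) 0) / max t 1 := by
  refine intervalIntegral.integral_congr fun t ht => ?_
  rw [uIcc_of_le hu] at ht
  rw [max_eq_left (by linarith [ht.1]), max_eq_left ht.1]

theorem continuousOn_dickmanApprox (k : ℕ) : ContinuousOn (dickmanApprox k) (Ici 0) := by
  induction k with
  | zero =>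
    refine (continuousOn_const (c := 1)).congr fun u hu => ?_
    simp [dickmanApprox, not_lt.2 (mem_Ici.1 hu)]
  | succ k ih =>
    have hc := continuous_delayed_quotient ih
    have h1 : Continuous (fun u : ℝ => 1 - ∫ t in (1 : ℝ)..max u 1,
        dickmanApprox k (max (t - 1) 0) / max t 1) :=
      continuous_const.sub
        ((intervalIntegral.continuous_primitive (fun a b => hc.intervalIntegrable a b) 1).comp
          (by fun_prop : Continuous fun u : ℝ => max u 1))
    refine h1.continuousOn.congr fun u hu => ?_
    rw [dickmanApprox_succ_of_nonneg _ hu, delayed_quotient_integral _ (le_max_right _ _)]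

theorem continuousOn_dickman : ContinuousOn dickman (Ici 0) := by
  intro u hu
  have h1 := Nat.lt_floor_add_one u
  refine (continuousOn_dickmanApprox ⌊u⌋₊ u hu).congr_of_eventuallyEq ?_ rfl
  filter_upwards [nhdsWithin_le_nhds (Iio_mem_nhds h1)] with v hv
  exact (dickmanApprox_eq_dickman hv).symm

theorem continuous_dickman_max : Continuous (fun u => dickman (max u 0)) :=
  continuousOn_dickman.comp_continuous (by fun_prop) fun _ => mem_Ici.2 (le_max_right _ _)

theorem causal_dickman : Causal dickman := by
  have heq : dickman = (Ici (0 : ℝ)).indicator (fun u => dickman (max u 0)) := by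
    ext u
    by_cases hu : 0 ≤ u
    · rw [indicator_of_mem (mem_Ici.2 hu), max_eq_left hu]
    · rw [indicator_of_notMem (by simpa using hu), dickman_of_neg (not_le.1 hu)]
  refine ⟨?_, fun u hu => dickman_of_neg hu, fun a => ?_⟩
  · rw [heq]
    exact continuous_dickman_max.measurable.indicator measurableSet_Ici
  · obtain ⟨C, hC⟩ := (isCompact_Icc (a := (0 : ℝ)) (b := |a|)).exists_bound_of_continuousOn
      continuous_dickman_max.continuousOn
    have h0 : 0 ≤ C := (norm_nonneg _).trans (hC 0 ⟨le_rfl, abs_nonneg a⟩)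
    refine ⟨C, fun u hu => ?_⟩
    rcases lt_or_ge u 0 with h | h
    · simpa [dickman_of_neg h] using h0
    · have := hC u ⟨h, hu.trans (le_abs_self a)⟩
      rwa [max_eq_left h] at this

theorem dickmanDeriv_of_lt_one {u : ℝ} (hu : u < 1) : dickmanDeriv u = 0 := by
  have h : HasDerivWithinAt dickman 0 (Ici u) u := by
    rcases lt_or_ge u 0 with h | h
    · refine (hasDerivWithinAt_const u _ (0 : ℝ)).congr_of_eventuallyEq ?_ (dickman_of_neg h)
      filter_upwards [nhdsWithin_le_nhds (Iio_mem_nhds h)] with v hv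
      exact dickman_of_neg hv
    · refine (hasDerivWithinAt_const u _ (1 : ℝ)).congr_of_eventuallyEq ?_
        (dickman_of_le_one h hu.le)
      filter_upwards [nhdsWithin_le_nhds (Iio_mem_nhds hu), self_mem_nhdsWithin] with v hv hv'
      exact dickman_of_le_one (h.trans hv') (le_of_lt hv)
  exact h.derivWithin (uniqueDiffWithinAt_Ici u)

theorem dickmanDeriv_of_one_le {u : ℝ} (hu : 1 ≤ u) : dickmanDeriv u = -(dickman (u - 1) / u) := by
  have hc := continuous_delayed_quotient continuousOn_dickman
  have h : HasDerivWithinAt dickman (-(dickman (max (u - 1) 0) / max u 1)) (Ici u) u := by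
    have h1 := (hc.integral_hasStrictDerivAt 1 u).hasDerivAt.const_sub 1
    have key : ∀ v ∈ Ici u, dickman v =
        1 - ∫ t in (1 : ℝ)..v, dickman (max (t - 1) 0) / max t 1 := fun v hv => by
      have hv1 : 1 ≤ v := hu.trans hv
      rw [dickman_eq_one_sub_integral (by linarith), max_eq_left hv1,
        delayed_quotient_integral _ hv1]
    exact h1.hasDerivWithinAt.congr key (key u self_mem_Ici)
  rw [max_eq_left (by linarith), max_eq_left hu] at h
  exact h.derivWithin (uniqueDiffWithinAt_Ici u)

/-- The extension of ρ by zero makes the delay equation valid on all of ℝ, with no boundary terms.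
-/
theorem mul_dickmanDeriv (u : ℝ) : u * dickmanDeriv u = -dickman (u - 1) := by
  rcases lt_or_ge u 1 with h | h
  · rw [dickmanDeriv_of_lt_one h, dickman_of_neg (by linarith)]; simp
  · rw [dickmanDeriv_of_one_le h]
    have : u ≠ 0 := by linarith
    field_simp

theorem causal_dickmanDeriv : Causal dickmanDeriv := by
  have heq : dickmanDeriv = (Ici (1 : ℝ)).indicator (fun u => -(dickman (u - 1) / u)) := by
    ext u
    by_cases hu : 1 ≤ u
    · rw [indicator_of_mem (mem_Ici.2 hu), dickmanDeriv_of_one_le hu]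
    · rw [indicator_of_notMem (by simpa using hu), dickmanDeriv_of_lt_one (not_le.1 hu)]
  refine ⟨?_, fun u hu => dickmanDeriv_of_lt_one (by linarith), fun a => ?_⟩
  · rw [heq]
    exact ((causal_dickman.measurable.comp (measurable_id.sub_const 1)).div
      measurable_id).neg.indicator measurableSet_Ici
  · obtain ⟨C, hC⟩ := causal_dickman.bdd a
    have h0 : 0 ≤ C := (abs_nonneg _).trans (hC a le_rfl)
    refine ⟨C, fun u hu => ?_⟩
    rcases lt_or_ge u 1 with h | h
    · simpa [dickmanDeriv_of_lt_one h] using h0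
    · rw [dickmanDeriv_of_one_le h, abs_neg, abs_div, abs_of_pos (by linarith : 0 < u)]
      exact (div_le_self (abs_nonneg _) h).trans (hC _ (by linarith))

theorem integral_dickmanDeriv {u : ℝ} (hu : 0 ≤ u) :
    ∫ t in (0 : ℝ)..u, dickmanDeriv t = dickman u - 1 := by
  have h0 : ∀ v ≤ 1, 0 ≤ v → ∫ t in (0 : ℝ)..v, dickmanDeriv t = 0 := fun v hv hv0 => by
    rw [intervalIntegral.integral_of_le hv0, integral_Ioc_eq_integral_Ioo]
    exact setIntegral_eq_zero_of_forall_eq_zero fun t ht =>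
      dickmanDeriv_of_lt_one (ht.2.trans_le hv)
  rcases le_total u 1 with h | h
  · rw [h0 u h hu, dickman_of_le_one hu h, sub_self]
  · rw [← intervalIntegral.integral_add_adjacent_intervals
      (causal_dickmanDeriv.intervalIntegrable 0 1) (causal_dickmanDeriv.intervalIntegrable 1 u),
      h0 1 le_rfl zero_le_one, dickman_eq_one_sub_integral hu, max_eq_left h, zero_add,
      sub_sub_cancel_left, ← intervalIntegral.integral_neg]
    refine intervalIntegral.integral_congr fun t ht => ?_
    rw [uIcc_of_le h] at ht
    exact dickmanDeriv_of_one_le ht.1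

/-- ρ is recovered from its jump at 0 and its derivative: formally ρ = (δ + ρ') * H. -/
theorem dickman_eq_heaviside_add : dickman = heaviside + conv dickmanDeriv heaviside := by
  ext u
  rw [Pi.add_apply]
  rcases lt_or_ge u 0 with h | h
  · rw [dickman_of_neg h, heaviside_of_neg h,
      (causal_dickmanDeriv.conv causal_heaviside).zero u h, add_zero]
  · rw [causal_dickmanDeriv.conv_heaviside h, integral_dickmanDeriv h, heaviside_of_nonneg h]
    ring

/-! ### Buchstab's function -/

theorem buchstabApprox_succ (k : ℕ) (u : ℝ) : buchstabApprox (k + 1) u =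
    if u < 1 then 0 else (1 + ∫ t in (1 : ℝ)..max (u - 1) 1, buchstabApprox k t) / u := by
  rw [buchstabApprox]
  split_ifs with h1 h2
  · rfl
  · rw [max_eq_right (by linarith)]; simp
  · rw [max_eq_left (by linarith)]

theorem buchstabApprox_succ_eq (k : ℕ) :
    ∀ u : ℝ, u < k + 1 → buchstabApprox (k + 1) u = buchstabApprox k u := by
  induction k with
  | zero =>
    intro u hu
    simp only [Nat.cast_zero, zero_add] at hu
    simp [buchstabApprox, hu]
  | succ k ih =>
    intro u hu
    rw [buchstabApprox_succ, buchstabApprox_succ]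
    rcases lt_or_ge u 1 with h | h
    · simp [h]
    · rw [if_neg h.not_gt, if_neg h.not_gt]
      congr 2
      -- The endpoint t = 1 must be excluded: for k = 0 the two approximations differ there, since ω
      -- jumps at 1.
      refine intervalIntegral.integral_congr_ae ?_
      refine Eventually.of_forall fun t ht => ?_
      rw [uIoc_of_le (le_max_right _ _)] at ht
      apply ih
      push_cast at hu
      rcases le_max_iff.1 ht.2 with h | h <;> linarith [ht.1]

theorem buchstabApprox_eq_buchstab {k : ℕ} {u : ℝ} (hu : u < k + 1) :
    buchstabApprox k u = buchstab u := by
  have hk : ⌊u⌋₊ ≤ k := by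
    rcases lt_or_ge u 0 with h | h
    · simp [Nat.floor_of_nonpos h.le]
    · exact Nat.lt_succ_iff.1 ((Nat.floor_lt h).2 (by exact_mod_cast hu))
  have h1 := Nat.lt_floor_add_one u
  rw [buchstab]
  induction k, hk using Nat.le_induction with
  | base => rfl
  | succ n hn ih =>
    have h2 : u < n + 1 := h1.trans_le (by exact_mod_cast Nat.succ_le_succ hn)
    rw [buchstabApprox_succ_eq n u h2, ih h2]

theorem buchstab_of_lt_one {u : ℝ} (hu : u < 1) : buchstab u = 0 := by
  rw [← buchstabApprox_eq_buchstab (k := 0) (by simpa using hu)]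
  simp [buchstabApprox]

theorem buchstab_of_one_le {u : ℝ} (hu : 1 ≤ u) :
    buchstab u = (1 + ∫ t in (1 : ℝ)..max (u - 1) 1, buchstab t) / u := by
  have h1 := Nat.lt_floor_add_one u
  rw [← buchstabApprox_eq_buchstab (k := ⌊u⌋₊ + 1) (by push_cast; linarith),
    buchstabApprox_succ, if_neg hu.not_gt]
  congr 2
  refine intervalIntegral.integral_congr_ae (Eventually.of_forall fun t ht => ?_)
  rw [uIoc_of_le (le_max_right _ _)] at ht
  apply buchstabApprox_eq_buchstab
  rcases le_max_iff.1 ht.2 with h | h <;> linarith [ht.1]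

/-- If 0 ≤ ω ≤ 1 up to u - 1, the numerator 1 + ∫ω is at most max(u - 1, 1) ≤ u. Measurability is
carried along because the integral needs it. -/
theorem buchstabApprox_bounds (k : ℕ) :
    Measurable (buchstabApprox k) ∧ ∀ u, 0 ≤ buchstabApprox k u ∧ buchstabApprox k u ≤ 1 := by
  induction k with
  | zero =>
    have : buchstabApprox 0 = fun _ => 0 := by ext u; rw [buchstabApprox]
    rw [this]
    exact ⟨measurable_const, fun u => ⟨le_rfl, zero_le_one⟩⟩
  | succ k ih =>
    have hint : ∀ a b, IntervalIntegrable (buchstabApprox k) volume a b := fun a b => by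
      rw [intervalIntegrable_iff]
      refine Measure.integrableOn_of_bounded (M := 1) (by simp) ih.1.aestronglyMeasurable
        (Eventually.of_forall fun u => ?_)
      rw [Real.norm_eq_abs, abs_of_nonneg (ih.2 u).1]
      exact (ih.2 u).2
    constructor
    · have heq : buchstabApprox (k + 1) = fun u => if u < 1 then 0 else
        (1 + ∫ t in (1 : ℝ)..max (u - 1) 1, buchstabApprox k t) / u :=
        funext (buchstabApprox_succ k)
      rw [heq]
      have hc : Continuous fun u : ℝ => ∫ t in (1 : ℝ)..max (u - 1) 1, buchstabApprox k t :=
        (intervalIntegral.continuous_primitive hint 1).comp (by fun_prop)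
      exact Measurable.ite measurableSet_Iio measurable_const
        ((measurable_const.add hc.measurable).div measurable_id)
    · intro u
      rw [buchstabApprox_succ]
      split_ifs with h
      · exact ⟨le_rfl, zero_le_one⟩
      · have hu : 1 ≤ u := not_lt.1 h
        have hm : (1 : ℝ) ≤ max (u - 1) 1 := le_max_right _ _
        have h0 : 0 ≤ ∫ t in (1 : ℝ)..max (u - 1) 1, buchstabApprox k t :=
          intervalIntegral.integral_nonneg hm fun t _ => (ih.2 t).1
        have h1 : ∫ t in (1 : ℝ)..max (u - 1) 1, buchstabApprox k t ≤
            ∫ t in (1 : ℝ)..max (u - 1) 1, (1 : ℝ) :=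
          intervalIntegral.integral_mono_on hm (hint _ _) (by simp) fun t _ => (ih.2 t).2
        rw [intervalIntegral.integral_const, smul_eq_mul, mul_one] at h1
        refine ⟨by positivity, (div_le_one (by linarith)).2 ?_⟩
        have : max (u - 1) 1 ≤ u := max_le (by linarith) hu
        linarith

theorem causal_buchstab : Causal buchstab := by
  refine ⟨?_, fun u hu => buchstab_of_lt_one (by linarith), fun a => ⟨1, fun u _ => ?_⟩⟩
  -- The approximation index ⌊u⌋₊ varies with u, but it ranges over a countable set, so joint
  -- measurability is enough.
  · have : Measurable (fun p : ℕ × ℝ => buchstabApprox p.1 p.2) :=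
      measurable_from_prod_countable_right fun k => (buchstabApprox_bounds k).1
    exact this.comp (Nat.measurable_floor.prodMk measurable_id)
  · have := (buchstabApprox_bounds ⌊u⌋₊).2 u
    rw [buchstab, abs_of_nonneg this.1]
    exact this.2

theorem mul_buchstab (u : ℝ) :
    u * buchstab u = heaviside (u - 1) + conv buchstab heaviside (u - 1) := by
  rcases lt_or_ge u 1 with h | h
  · rw [buchstab_of_lt_one h, heaviside_of_neg (by linarith),
      (causal_buchstab.conv causal_heaviside).zero _ (by linarith)]
    simp
  · rw [buchstab_of_one_le h, heaviside_of_nonneg (by linarith),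
      causal_buchstab.conv_heaviside (by linarith), mul_div_cancel₀ _ (by linarith : u ≠ 0)]
    congr 1
    have h0 : ∀ v ≤ 1, 0 ≤ v → ∫ t in (0 : ℝ)..v, buchstab t = 0 := fun v hv hv0 => by
      rw [intervalIntegral.integral_of_le hv0, integral_Ioc_eq_integral_Ioo]
      exact setIntegral_eq_zero_of_forall_eq_zero fun t ht =>
        buchstab_of_lt_one (ht.2.trans_le hv)
    rcases le_total (u - 1) 1 with h1 | h1
    · rw [max_eq_right h1, h0 _ h1 (by linarith), intervalIntegral.integral_same]
    · rw [max_eq_left h1, ← intervalIntegral.integral_add_adjacent_intervals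
        (causal_buchstab.intervalIntegrable 0 1) (causal_buchstab.intervalIntegrable 1 (u - 1)),
        h0 1 le_rfl zero_le_one, zero_add]

/-! ### The convolution inverse -/

/-- The delay equation as u(δ + ρ') = -T * (δ + ρ') with T = H(· - 1), since uδ = 0. The equation
for ω has the opposite sign, so the product of the two has zero derivation. -/
theorem mul_dickmanDeriv_eq :
    (fun u => u * dickmanDeriv u) =
      -((fun u => heaviside (u - 1)) + conv dickmanDeriv fun u => heaviside (u - 1)) := by
  ext u
  rw [mul_dickmanDeriv, Pi.neg_apply, Pi.add_apply, conv_shift, dickman_eq_heaviside_add]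
  rfl

theorem mul_buchstab_eq :
    (fun u => u * buchstab u) =
      (fun u => heaviside (u - 1)) + conv buchstab fun u => heaviside (u - 1) := by
  ext u
  rw [mul_buchstab, Pi.add_apply, conv_shift]

/-- `δ + ρ'` and `δ + ω` are inverse to each other for the convolution. -/
theorem dickmanDeriv_conv_buchstab :
    conv dickmanDeriv buchstab = -(dickmanDeriv + buchstab) := by
  have hr := causal_dickmanDeriv
  have hw := causal_buchstab
  have hT : Causal (fun u => heaviside (u - 1)) := causal_heaviside.shift zero_le_one
  ext u
  -- The derivation argument determines values only up to the factor u, so u = 0 is checked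
  -- directly.
  rcases eq_or_ne u 0 with rfl | hu
  · rw [conv_apply, Pi.neg_apply, Pi.add_apply, dickmanDeriv_of_lt_one one_pos,
      buchstab_of_lt_one one_pos, integral_eq_zero_of_ae]
    · simp
    · refine Eventually.of_forall fun v => ?_
      simp only [Pi.zero_apply]
      rcases lt_or_ge v 1 with h | h
      · rw [dickmanDeriv_of_lt_one h, zero_mul]
      · rw [buchstab_of_lt_one (by linarith), mul_zero]
  · refine mul_left_cancel₀ hu ?_
    have h1 := congrFun mul_dickmanDeriv_eq u
    have h2 := congrFun mul_buchstab_eq u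
    -- In the Leibniz expansion of u(ρ' * ω) the triple products ρ' * T * ω cancel.
    rw [hr.mul_conv hw, mul_dickmanDeriv_eq, mul_buchstab_eq, neg_conv,
      hT.add_conv (hr.conv hT) hw, hr.conv_add hT (hw.conv hT), hr.conv_assoc hT hw,
      conv_comm (fun u => heaviside (u - 1)) buchstab]
    simp only [Pi.neg_apply, Pi.add_apply] at h1 h2 ⊢
    linear_combination h1 + h2

theorem dickman_conv_buchstab : conv dickman buchstab = heaviside - dickman := by
  have hr := causal_dickmanDeriv
  have hw := causal_buchstab
  have hH := causal_heaviside
  have h : conv dickman buchstab =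
      conv heaviside buchstab + conv (conv dickmanDeriv heaviside) buchstab := by
    conv_lhs => rw [dickman_eq_heaviside_add]
    exact hH.add_conv (hr.conv hH) hw
  rw [h, conv_comm dickmanDeriv, hH.conv_assoc hr hw, dickmanDeriv_conv_buchstab, conv_neg,
    hH.conv_add hr hw, conv_comm heaviside dickmanDeriv]
  conv_rhs => rw [dickman_eq_heaviside_add]
  abel

/-- `u ρ(u) = ∫_{u-1}^u ρ`, in convolution form. -/
theorem mul_dickman :
    (fun u => u * dickman u) = conv dickman heaviside - conv dickman fun u => heaviside (u - 1) := by
  have hr := causal_dickmanDeriv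
  have hH := causal_heaviside
  have hT : Causal (fun u => heaviside (u - 1)) := hH.shift zero_le_one
  -- This is the derivation rule for H; the claim follows by applying the Leibniz rule to ρ = H + ρ'
  -- * H.
  have hid : (fun u => u * heaviside u) = conv heaviside heaviside := by
    ext u
    rcases lt_or_ge u 0 with h | h
    · rw [heaviside_of_neg h, (hH.conv hH).zero u h, mul_zero]
    · rw [hH.conv_heaviside h, heaviside_of_nonneg h]
      have : ∫ v in (0 : ℝ)..u, heaviside v = ∫ v in (0 : ℝ)..u, (1 : ℝ) :=
        intervalIntegral.integral_congr fun v hv => by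
          rw [uIcc_of_le h] at hv
          exact heaviside_of_nonneg hv.1
      rw [this]; simp
  have hexp : ∀ {k : ℝ → ℝ}, Causal k →
      conv dickman k = conv heaviside k + conv dickmanDeriv (conv heaviside k) := fun {k} hk => by
    rw [← hr.conv_assoc hH hk, ← hH.add_conv (hr.conv hH) hk, ← dickman_eq_heaviside_add]
  ext u
  have h1 : u * dickman u = u * heaviside u + u * conv dickmanDeriv heaviside u := by
    rw [← mul_add]; conv_lhs => rw [dickman_eq_heaviside_add]
    rfl
  rw [h1, hr.mul_conv hH, hid, mul_dickmanDeriv_eq, hexp hH, hexp hT, neg_conv,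
    hT.add_conv (hr.conv hT) hH, hr.conv_assoc hT hH, conv_comm _ heaviside,
    conv_comm _ heaviside]
  have h2 := congrFun hid u
  simp only [Pi.neg_apply, Pi.add_apply, Pi.sub_apply] at h2 ⊢
  linear_combination h2

/-! ### Bounds for Dickman's function -/

theorem mul_dickman_eq_integral {u : ℝ} (hu : 1 ≤ u) :
    u * dickman u = ∫ t in (u - 1)..u, dickman t := by
  have h := congrFun mul_dickman u
  rw [Pi.sub_apply, conv_shift, causal_dickman.conv_heaviside (by linarith),
    causal_dickman.conv_heaviside (by linarith), intervalIntegral.integral_interval_sub_left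
      (causal_dickman.intervalIntegrable _ _) (causal_dickman.intervalIntegrable _ _)] at h
  exact h

theorem dickman_sub_dickman {a b : ℝ} (ha : 0 ≤ a) (hab : a ≤ b) :
    dickman b - dickman a = ∫ t in a..b, dickmanDeriv t := by
  rw [← intervalIntegral.integral_interval_sub_left
    (causal_dickmanDeriv.intervalIntegrable 0 b) (causal_dickmanDeriv.intervalIntegrable 0 a),
    integral_dickmanDeriv ha, integral_dickmanDeriv (ha.trans hab)]
  ring

theorem dickman_le_of_nonneg_before {a b : ℝ} (ha : 0 ≤ a) (hab : a ≤ b)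
    (h : ∀ t ≤ b - 1, 0 ≤ dickman t) : dickman b ≤ dickman a := by
  rw [← sub_nonpos, dickman_sub_dickman ha hab, intervalIntegral.integral_of_le hab]
  refine setIntegral_nonpos measurableSet_Ioc fun t ht => ?_
  rcases lt_or_ge t 1 with h1 | h1
  · rw [dickmanDeriv_of_lt_one h1]
  · rw [dickmanDeriv_of_one_le h1, neg_nonpos]
    exact div_nonneg (h _ (by linarith [ht.2])) (by linarith)

theorem integral_dickman_mono {u c d : ℝ} (h : ∀ t ∈ Icc (u - 1) u, c ≤ dickman t ∧ dickman t ≤ d) :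
    c ≤ ∫ t in (u - 1)..u, dickman t ∧ ∫ t in (u - 1)..u, dickman t ≤ d := by
  have hi := causal_dickman.intervalIntegrable (u - 1) u
  constructor
  · have := intervalIntegral.integral_mono_on (by linarith) (intervalIntegrable_const (c := c)) hi
      fun t ht => (h t ht).1
    simpa using this
  · have := intervalIntegral.integral_mono_on (by linarith) hi (intervalIntegrable_const (c := d))
      fun t ht => (h t ht).2
    simpa using this

/-- Induction over unit intervals. If ρ ≥ 0 up to u - 1, then ρ is nonincreasing on [u - 1, u], so
uρ(u) = ∫ρ ≥ ρ(u), which with u > 1 rules out ρ(u) < 0. -/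
theorem dickman_nonneg (u : ℝ) : 0 ≤ dickman u := by
  have key : ∀ k : ℕ, ∀ u : ℝ, u ≤ k + 1 → 0 ≤ dickman u := by
    intro k
    induction k with
    | zero =>
      intro u hu
      rcases lt_or_ge u 0 with h | h
      · rw [dickman_of_neg h]
      · rw [dickman_of_le_one h (by simpa using hu)]; exact zero_le_one
    | succ k ih =>
      intro u hu
      push_cast at hu
      rcases le_or_gt u (k + 1) with h | h
      · exact ih u h
      · have hk : (0 : ℝ) ≤ k := k.cast_nonneg
        have hb : ∀ t ≤ u - 1, 0 ≤ dickman t := fun t ht => ih t (by linarith)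
        have hc : ContinuousOn dickman (Icc (u - 1) u) :=
          continuousOn_dickman.mono fun t ht => mem_Ici.2 (by linarith [ht.1])
        obtain ⟨d, hd⟩ := isCompact_Icc.bddAbove_image hc
        have := (integral_dickman_mono (u := u) (c := dickman u) (d := d) fun t ht =>
          ⟨dickman_le_of_nonneg_before (by linarith [ht.1]) ht.2 hb,
            hd (mem_image_of_mem _ ht)⟩).1
        rw [← mul_dickman_eq_integral (by linarith)] at this
        by_contra! hneg
        nlinarith
  exact key ⌈u⌉₊ u ((Nat.le_ceil u).trans (by linarith))

theorem dickman_antitone {a b : ℝ} (ha : 0 ≤ a) (hab : a ≤ b) : dickman b ≤ dickman a :=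
  dickman_le_of_nonneg_before ha hab fun t _ => dickman_nonneg t

theorem dickman_le_one (u : ℝ) : dickman u ≤ 1 := by
  rcases lt_or_ge u 0 with h | h
  · rw [dickman_of_neg h]; exact zero_le_one
  · rw [← dickman_of_le_one le_rfl zero_le_one]
    exact dickman_antitone le_rfl h

theorem mul_dickman_le {u : ℝ} (hu : 1 ≤ u) : u * dickman u ≤ dickman (u - 1) := by
  rw [mul_dickman_eq_integral hu]
  exact (integral_dickman_mono (c := 0) fun t ht =>
    ⟨dickman_nonneg t, dickman_antitone (by linarith) ht.1⟩).2

/-- For u > 3, uρ(u) ≤ ρ(u - 1) makes each unit step divide ρ by at least 3 > e; for u ≤ 3 the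
trivial bound 1 is enough. -/
theorem dickman_le_exp (u : ℝ) : dickman u ≤ Real.exp (3 - u) := by
  have key : ∀ k : ℕ, ∀ u : ℝ, u ≤ k + 3 → dickman u ≤ Real.exp (3 - u) := by
    intro k
    induction k with
    | zero =>
      intro u hu
      push_cast at hu
      exact (dickman_le_one u).trans (Real.one_le_exp (by linarith))
    | succ k ih =>
      intro u hu
      push_cast at hu
      rcases le_or_gt u (k + 3) with h | h
      · exact ih u h
      · have hk : (0 : ℝ) ≤ k := k.cast_nonneg
        have h1 := (mul_dickman_le (by linarith : 1 ≤ u)).trans (ih (u - 1) (by linarith))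
        have h2 : Real.exp (3 - (u - 1)) = Real.exp (3 - u) * Real.exp 1 := by
          rw [← Real.exp_add]; ring_nf
        rw [h2] at h1
        have h3 := Real.exp_one_lt_d9
        have h4 := Real.exp_pos (3 - u)
        have h5 : 3 * dickman u ≤ u * dickman u :=
          mul_le_mul_of_nonneg_right (by linarith) (dickman_nonneg u)
        have h6 : Real.exp (3 - u) * Real.exp 1 ≤ Real.exp (3 - u) * 3 :=
          mul_le_mul_of_nonneg_left (by linarith) h4.le
        linarith
  exact key ⌈u⌉₊ u ((Nat.le_ceil u).trans (by linarith))

/-! ### Exponentially decaying causal functions -/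

/-- The function `u ↦ e^{-bu}` on `[0, ∞)`, extended by zero. -/
noncomputable def expDecay (b : ℝ) : ℝ → ℝ := (Ici (0 : ℝ)).indicator fun u => Real.exp (-b * u)

theorem expDecay_of_nonneg (b : ℝ) {u : ℝ} (hu : 0 ≤ u) : expDecay b u = Real.exp (-b * u) := by
  simp [expDecay, hu]

theorem expDecay_of_neg (b : ℝ) {u : ℝ} (hu : u < 0) : expDecay b u = 0 := by
  simp [expDecay, hu]

theorem expDecay_nonneg (b u : ℝ) : 0 ≤ expDecay b u :=
  indicator_nonneg (fun _ _ => (Real.exp_pos _).le) u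

theorem causal_expDecay {b : ℝ} (hb : 0 < b) : Causal (expDecay b) := by
  refine ⟨Measurable.indicator (by fun_prop) measurableSet_Ici, fun u hu => expDecay_of_neg b hu,
    fun a => ⟨1, fun u _ => ?_⟩⟩
  rcases lt_or_ge u 0 with h | h
  · simp [expDecay_of_neg b h]
  · rw [expDecay_of_nonneg b h, abs_of_pos (Real.exp_pos _), Real.exp_le_one_iff]
    nlinarith

theorem integrable_expDecay {b : ℝ} (hb : 0 < b) : Integrable (expDecay b) := by
  rw [expDecay, integrable_indicator_iff measurableSet_Ici, integrableOn_Ici_iff_integrableOn_Ioi]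
  exact exp_neg_integrableOn_Ioi 0 hb

theorem integral_expDecay {b : ℝ} (hb : 0 < b) : ∫ u, expDecay b u = 1 / b := by
  rw [expDecay, integral_indicator measurableSet_Ici, integral_Ici_eq_integral_Ioi,
    integral_exp_mul_Ioi (by linarith : -b < 0)]
  simp [neg_div_neg_eq]

theorem integrable_of_le_expDecay {f : ℝ → ℝ} (hf : Measurable f) {b C : ℝ} (hb : 0 < b)
    (h : ∀ u, |f u| ≤ C * expDecay b u) : Integrable f :=
  ((integrable_expDecay hb).const_mul C).mono' hf.aestronglyMeasurable (Eventually.of_forall h)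

theorem abs_dickman_le (u : ℝ) : |dickman u| ≤ Real.exp 3 * expDecay 1 u := by
  rcases lt_or_ge u 0 with h | h
  · simp [dickman_of_neg h, expDecay_of_neg 1 h]
  · rw [abs_of_nonneg (dickman_nonneg u), expDecay_of_nonneg 1 h, ← Real.exp_add]
    convert! dickman_le_exp u using 2
    ring

theorem integrable_dickman : Integrable dickman :=
  integrable_of_le_expDecay causal_dickman.measurable one_pos abs_dickman_le

theorem integrable_dickmanDeriv : Integrable dickmanDeriv := by
  -- The exponent 4 is 3 plus the unit delay: ρ(u - 1) ≤ e^{4 - u}.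
  refine integrable_of_le_expDecay (C := Real.exp 4) causal_dickmanDeriv.measurable one_pos
    fun u => ?_
  rcases lt_or_ge u 1 with h | h
  · rw [dickmanDeriv_of_lt_one h, abs_zero]
    exact mul_nonneg (Real.exp_pos _).le (expDecay_nonneg _ _)
  · rw [dickmanDeriv_of_one_le h, abs_neg, abs_of_nonneg (div_nonneg (dickman_nonneg _)
      (by linarith)), expDecay_of_nonneg 1 (by linarith), ← Real.exp_add]
    refine (div_le_self (dickman_nonneg _) h).trans ((dickman_le_exp _).trans (le_of_eq ?_))
    congr 1; ring

theorem tendsto_dickman_atTop : Tendsto dickman atTop (𝓝 0) := by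
  refine squeeze_zero dickman_nonneg dickman_le_exp (Real.tendsto_exp_atBot.comp ?_)
  exact tendsto_atBot_add_const_left _ 3 tendsto_neg_atTop_atBot

theorem Causal.integral_Ioi {f : ℝ → ℝ} (hf : Causal f) (g : ℝ → ℝ) :
    ∫ u in Ioi 0, f u * g u = ∫ u, f u * g u := by
  rw [← integral_Ici_eq_integral_Ioi]
  refine setIntegral_eq_integral_of_forall_compl_eq_zero fun u hu => ?_
  rw [hf.zero u (by simpa using hu), zero_mul]

theorem integral_dickmanDeriv_univ : ∫ u, dickmanDeriv u = -1 := by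
  have h1 := intervalIntegral_tendsto_integral_Ioi 0 integrable_dickmanDeriv.integrableOn tendsto_id
  have h2 : Tendsto (fun u => ∫ t in (0 : ℝ)..id u, dickmanDeriv t) atTop (𝓝 (0 - 1)) := by
    refine (tendsto_dickman_atTop.sub_const 1).congr' ?_
    filter_upwards [eventually_ge_atTop 0] with u hu
    exact (integral_dickmanDeriv hu).symm
  have h3 := causal_dickmanDeriv.integral_Ioi 1
  simp only [Pi.one_apply, mul_one] at h3
  rw [← h3, tendsto_nhds_unique h1 h2]
  norm_num

/-! ### The total mass of Dickman's function -/

/-- `∫_0^1 e^{-st} dt = (1 - e^{-s}) / s`. -/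
noncomputable def expMean (s : ℝ) : ℝ := ∫ t in (0 : ℝ)..1, Real.exp (-s * t)

theorem expMean_eq {s : ℝ} (hs : s ≠ 0) : expMean s = (1 - Real.exp (-s)) / s := by
  rw [expMean, intervalIntegral.integral_comp_mul_left _ (neg_ne_zero.2 hs), integral_exp]
  simp only [mul_one, mul_zero, Real.exp_zero, smul_eq_mul]
  field_simp
  ring

theorem continuous_expMean : Continuous expMean :=
  intervalIntegral.continuous_parametric_intervalIntegral_of_continuous' (by fun_prop) 0 1

/-- The entire exponential integral `∫_0^s (1 - e^{-t}) / t dt`. -/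
noncomputable def expEin (s : ℝ) : ℝ := ∫ t in (0 : ℝ)..s, expMean t

theorem hasDerivAt_expEin (s : ℝ) : HasDerivAt expEin (expMean s) s :=
  (continuous_expMean.integral_hasStrictDerivAt 0 s).hasDerivAt

theorem harmonic_eq_integral (n : ℕ) :
    (harmonic n : ℝ) = ∫ x in (0 : ℝ)..1, ∑ k ∈ Finset.range n, (1 - x) ^ k := by
  rw [intervalIntegral.integral_finsetSum fun k _ =>
    (by fun_prop : Continuous fun x : ℝ => (1 - x) ^ k).intervalIntegrable 0 1, harmonic]
  push_cast
  refine Finset.sum_congr rfl fun k _ => ?_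
  rw [intervalIntegral.integral_comp_sub_left (fun x => x ^ k) 1]
  simp [integral_pow]

/-- The upper bound combines 1 - x² ≤ (1 - x)e^x, raised to the n-th power, with Bernoulli's
inequality. -/
theorem exp_neg_sub_pow_bounds (n : ℕ) {x : ℝ} (hx0 : 0 ≤ x) (hx1 : x ≤ 1) :
    0 ≤ Real.exp (-(n * x)) - (1 - x) ^ n ∧
      Real.exp (-(n * x)) - (1 - x) ^ n ≤ n * x ^ 2 * Real.exp (-(n * x)) := by
  have he : Real.exp (-(n * x)) = Real.exp (-x) ^ n := by
    rw [← Real.exp_nat_mul]; ring_nf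
  constructor
  · rw [he, sub_nonneg]
    exact pow_le_pow_left₀ (by linarith) (by linarith [Real.add_one_le_exp (-x)]) n
  · have h1 : (1 - x ^ 2) ^ n ≤ (1 - x) ^ n * Real.exp x ^ n := by
      rw [← mul_pow]
      refine pow_le_pow_left₀ (by nlinarith) ?_ n
      nlinarith [Real.add_one_le_exp x]
    have h2 : 1 - n * x ^ 2 ≤ (1 - x ^ 2) ^ n := by
      have := one_add_mul_le_pow (a := -x ^ 2) (by nlinarith) n
      calc 1 - n * x ^ 2 = 1 + n * -x ^ 2 := by ring
        _ ≤ (1 + -x ^ 2) ^ n := this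
        _ = _ := by rw [← sub_eq_add_neg]
    have h3 : (1 - x) ^ n * Real.exp x ^ n * Real.exp (-(n * x)) = (1 - x) ^ n := by
      rw [he, mul_assoc, ← mul_pow (Real.exp x), ← Real.exp_add, add_neg_cancel, Real.exp_zero,
        one_pow, mul_one]
    have h4 := mul_le_mul_of_nonneg_right (h2.trans h1) (Real.exp_pos (-(n * x))).le
    rw [h3] at h4
    linarith

theorem expEin_natCast (n : ℕ) : expEin n = ∫ x in (0 : ℝ)..1, n * expMean (n * x) := by
  rw [intervalIntegral.integral_const_mul, intervalIntegral.mul_integral_comp_mul_left]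
  simp [expEin]

/-- Both terms are integrals over [0, 1], and the integrands differ by (e^{-nx} - (1 - x)^n) / x.
This lies between 0 and nx e^{-nx} ≤ 2e^{-nx/2}, whose integral is at most 4/n. -/
theorem harmonic_sub_expEin_bounds {n : ℕ} (hn : 0 < n) :
    0 ≤ harmonic n - expEin n ∧ harmonic n - expEin n ≤ 4 / n := by
  have hn' : (0 : ℝ) < n := by exact_mod_cast hn
  have hcE : Continuous fun x : ℝ => n * expMean (n * x) :=
    continuous_const.mul (continuous_expMean.comp (by fun_prop))
  have hcS : Continuous fun x : ℝ => ∑ k ∈ Finset.range n, (1 - x) ^ k := by fun_prop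
  have hb : ∀ x ∈ Ioo (0 : ℝ) 1, 0 ≤ ∑ k ∈ Finset.range n, (1 - x) ^ k - n * expMean (n * x) ∧
      ∑ k ∈ Finset.range n, (1 - x) ^ k - n * expMean (n * x) ≤
        2 * Real.exp (-(n / 2) * x) := by
    intro x hx
    have hx0 : x ≠ 0 := hx.1.ne'
    have h1 : ∑ k ∈ Finset.range n, (1 - x) ^ k - n * expMean (n * x) =
        (Real.exp (-(n * x)) - (1 - x) ^ n) / x := by
      have hx' : 1 - x - 1 = -x := by ring
      rw [geom_sum_eq (by simpa using hx0), expMean_eq (by positivity), hx']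
      field_simp
      ring
    obtain ⟨h2, h3⟩ := exp_neg_sub_pow_bounds n hx.1.le hx.2.le
    rw [h1]
    refine ⟨div_nonneg h2 hx.1.le, (div_le_iff₀ hx.1).2 (h3.trans ?_)⟩
    have h4 : Real.exp (-(n * x)) = Real.exp (-(n / 2) * x) * Real.exp (-(n / 2) * x) := by
      rw [← Real.exp_add]; ring_nf
    have h5 : n / 2 * x * Real.exp (-(n / 2) * x) ≤ 1 := by
      have := Real.add_one_le_exp (n / 2 * x)
      have h6 : Real.exp (n / 2 * x) * Real.exp (-(n / 2) * x) = 1 := by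
        rw [← Real.exp_add]; simp
      rw [← h6]
      exact mul_le_mul_of_nonneg_right (by linarith) (Real.exp_pos _).le
    have h7 := mul_le_mul_of_nonneg_left h5
      (mul_nonneg (mul_nonneg zero_le_two hx.1.le) (Real.exp_pos (-(n / 2) * x)).le)
    rw [h4]
    calc _ = 2 * x * Real.exp (-(n / 2) * x) * (n / 2 * x * Real.exp (-(n / 2) * x)) := by ring
      _ ≤ _ := h7
      _ = _ := by ring
  have hexp : Continuous fun x : ℝ => 2 * Real.exp (-(n / 2) * x) := by fun_prop
  rw [harmonic_eq_integral, expEin_natCast,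
    ← intervalIntegral.integral_sub (hcS.intervalIntegrable _ _) (hcE.intervalIntegrable _ _)]
  constructor
  · rw [intervalIntegral.integral_of_le zero_le_one, integral_Ioc_eq_integral_Ioo]
    exact setIntegral_nonneg measurableSet_Ioo fun x hx => (hb x hx).1
  · have h1 : ∫ x in (0 : ℝ)..1, 2 * Real.exp (-(n / 2) * x) ≤ 4 / n := by
      rw [intervalIntegral.integral_const_mul]
      change 2 * expMean (n / 2) ≤ _
      rw [expMean_eq (by positivity)]
      have : 2 * ((1 - Real.exp (-((n : ℝ) / 2))) / (n / 2)) =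
        4 / n * (1 - Real.exp (-((n : ℝ) / 2))) := by field_simp; ring
      rw [this]
      exact mul_le_of_le_one_right (by positivity) (by linarith [Real.exp_pos (-((n : ℝ) / 2))])
    refine le_trans ?_ h1
    exact intervalIntegral.integral_mono_on_of_le_Ioo zero_le_one
      ((hcS.sub hcE).intervalIntegrable _ _) (hexp.intervalIntegrable _ _) fun x hx => (hb x hx).2

theorem tendsto_expEin_sub_log :
    Tendsto (fun n : ℕ => expEin n - Real.log n) atTop (𝓝 Real.eulerMascheroniConstant) := by
  have h1 : Tendsto (fun n : ℕ => (harmonic n : ℝ) - expEin n) atTop (𝓝 0) := by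
    refine tendsto_of_tendsto_of_tendsto_of_le_of_le' tendsto_const_nhds
      (tendsto_const_div_atTop_nhds_zero_nat 4) ?_ ?_ <;>
    filter_upwards [eventually_gt_atTop 0] with n hn
    · exact (harmonic_sub_expEin_bounds hn).1
    · exact (harmonic_sub_expEin_bounds hn).2
  have h2 := Real.tendsto_harmonic_sub_log.sub h1
  rw [sub_zero] at h2
  exact h2.congr fun n => by ring

/-- The Laplace transform of Dickman's function. -/
noncomputable def dickmanLaplace (s : ℝ) : ℝ := ∫ u, dickman u * Real.exp (-s * u)

theorem integrable_dickman_mul_exp {s : ℝ} (hs : 0 ≤ s) :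
    Integrable (fun u => dickman u * Real.exp (-s * u)) := by
  refine integrable_of_le_expDecay (b := 1) (C := Real.exp 3)
    (causal_dickman.measurable.mul (by fun_prop)) one_pos fun u => ?_
  rcases lt_or_ge u 0 with h | h
  · simp [dickman_of_neg h, expDecay_of_neg 1 h]
  · rw [abs_mul, abs_of_pos (Real.exp_pos _)]
    refine (mul_le_of_le_one_right (abs_nonneg _) ?_).trans (abs_dickman_le u)
    rw [Real.exp_le_one_iff]
    nlinarith

theorem hasDerivAt_dickmanLaplace {s : ℝ} (hs : 0 ≤ s) :
    HasDerivAt dickmanLaplace (∫ u, -(u * dickman u * Real.exp (-s * u))) s := by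
  have hm := causal_dickman.measurable
  refine (hasDerivAt_integral_of_dominated_loc_of_deriv_le
    (F' := fun t u => -(u * dickman u * Real.exp (-t * u)))
    -- On the ball -t < 1/2. With u ≤ 4e^{u/4} and ρ(u) ≤ e^{3 - u}, the total exponential rate is
    -- 1/4 - 1 + 1/2 = -1/4.
    (bound := fun u => 4 * Real.exp 3 * expDecay (1 / 4) u) (Metric.ball_mem_nhds s one_half_pos)
    (Eventually.of_forall fun t => (hm.mul (by fun_prop)).aestronglyMeasurable)
    (integrable_dickman_mul_exp hs)
    (((measurable_id.mul hm).mul (by fun_prop)).neg.aestronglyMeasurable)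
    (Eventually.of_forall fun u t ht => ?_)
    ((integrable_expDecay (by norm_num)).const_mul _)
    (Eventually.of_forall fun u t _ => ?_)).2
  · rcases lt_or_ge u 0 with h | h
    · simp [dickman_of_neg h, expDecay_of_neg _ h]
    · rw [Metric.mem_ball, Real.dist_eq, abs_lt] at ht
      rw [norm_neg, norm_mul, norm_mul, Real.norm_of_nonneg h, Real.norm_of_nonneg (dickman_nonneg u),
        Real.norm_of_nonneg (Real.exp_pos _).le, expDecay_of_nonneg _ h]
      have h1 : u ≤ 4 * Real.exp (1 / 4 * u) := by linarith [Real.add_one_le_exp (1 / 4 * u)]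
      have h2 := dickman_le_exp u
      have h3 : Real.exp (-t * u) ≤ Real.exp (1 / 2 * u) :=
        Real.exp_le_exp.2 (mul_le_mul_of_nonneg_right (by linarith) h)
      calc u * dickman u * Real.exp (-t * u)
          ≤ 4 * Real.exp (1 / 4 * u) * Real.exp (3 - u) * Real.exp (1 / 2 * u) := by
            gcongr
            exact dickman_nonneg u
        _ = 4 * (Real.exp (1 / 4 * u) * Real.exp (3 - u) * Real.exp (1 / 2 * u)) := by ring
        _ = 4 * (Real.exp 3 * Real.exp (-(1 / 4) * u)) := by
            rw [← Real.exp_add, ← Real.exp_add, ← Real.exp_add]; ring_nf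
        _ = _ := by ring
  · have h1 : HasDerivAt (fun t : ℝ => -t * u) (-u) t := by
      simpa using (hasDerivAt_id t).neg.mul_const u
    have h2 := (h1.exp).const_mul (dickman u)
    convert! h2 using 1
    ring

theorem conv_mul_exp (f g : ℝ → ℝ) (s u : ℝ) :
    conv f g u * Real.exp (-s * u) =
      conv (fun v => f v * Real.exp (-s * v)) (fun v => g v * Real.exp (-s * v)) u := by
  rw [conv_apply, conv_apply, ← integral_mul_const]
  congr 1; ext v
  have : Real.exp (-s * u) = Real.exp (-s * v) * Real.exp (-s * (u - v)) := by
    rw [← Real.exp_add]; ring_nf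
  rw [this]; ring

theorem integral_conv {f g : ℝ → ℝ} (hf : Integrable f) (hg : Integrable g) :
    ∫ u, conv f g u = (∫ u, f u) * ∫ u, g u := by
  simpa using integral_convolution (ContinuousLinearMap.mul ℝ ℝ) hf hg

/-- uρ(u) is the convolution of ρ with the indicator of [0, 1), and the Laplace transform turns this
into a product. -/
theorem integral_mul_dickman {s : ℝ} (hs : 0 ≤ s) :
    ∫ u, u * dickman u * Real.exp (-s * u) = dickmanLaplace s * expMean s := by
  have hH := causal_heaviside
  have hT : Causal (fun u => heaviside (u - 1)) := hH.shift zero_le_one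
  have hbox : (heaviside - fun u => heaviside (u - 1)) = (Ico (0 : ℝ) 1).indicator (1 : ℝ → ℝ) := by
    ext u
    rw [Pi.sub_apply]
    rcases lt_or_ge u 0 with h | h
    · rw [heaviside_of_neg h, heaviside_of_neg (by linarith), indicator_of_notMem (by simp [h])]
      simp
    · rcases lt_or_ge u 1 with h1 | h1
      · rw [heaviside_of_nonneg h, heaviside_of_neg (by linarith),
          indicator_of_mem (mem_Ico.2 ⟨h, h1⟩)]
        simp
      · rw [heaviside_of_nonneg h, heaviside_of_nonneg (by linarith),
          indicator_of_notMem (by simp [h1])]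
        simp
  have h1 : ∀ u, u * dickman u = conv dickman ((Ico (0 : ℝ) 1).indicator 1) u := fun u => by
    rw [← hbox, sub_eq_add_neg heaviside, causal_dickman.conv_add hH hT.neg, conv_neg]
    exact congrFun mul_dickman u
  have h2 : (fun v => (Ico (0 : ℝ) 1).indicator 1 v * Real.exp (-s * v)) =
      (Ico (0 : ℝ) 1).indicator fun v => Real.exp (-s * v) := by
    ext v; by_cases hv : v ∈ Ico (0 : ℝ) 1 <;> simp [hv]
  have h3 : Integrable ((Ico (0 : ℝ) 1).indicator fun v => Real.exp (-s * v)) := by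
    rw [integrable_indicator_iff measurableSet_Ico]
    exact ((by fun_prop : Continuous fun v : ℝ => Real.exp (-s * v)).integrableOn_Icc (a := 0)
      (b := 1)).mono_set Ico_subset_Icc_self
  simp_rw [h1, conv_mul_exp]
  rw [h2, integral_conv (integrable_dickman_mul_exp hs) h3, integral_indicator measurableSet_Ico,
    integral_Ico_eq_integral_Ioo, ← integral_Ioc_eq_integral_Ioo, ← intervalIntegral.integral_of_le zero_le_one]
  rfl

/-- The transform satisfies L' = -L · `expMean`, and `expMean` is the derivative of `expEin`. -/
theorem dickmanLaplace_mul_exp_expEin {s : ℝ} (hs : 0 ≤ s) :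
    dickmanLaplace s * Real.exp (expEin s) = dickmanLaplace 0 := by
  have hd : ∀ t : ℝ, 0 ≤ t →
      HasDerivAt (fun t => dickmanLaplace t * Real.exp (expEin t)) 0 t := fun t ht => by
    convert! (hasDerivAt_dickmanLaplace ht).mul (hasDerivAt_expEin t).exp using 1
    rw [integral_neg, integral_mul_dickman ht]
    ring
  have h := constant_of_has_deriv_right_zero (a := 0) (b := s)
    (fun t ht => (hd t ht.1).continuousAt.continuousWithinAt)
    (fun t ht => (hd t ht.1).hasDerivWithinAt) s ⟨hs, le_rfl⟩
  simpa [expEin] using h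

/-- On [0, ∞), ρ lies between the indicator of [0, 1] and 1; both have explicit transforms. -/
theorem mul_dickmanLaplace_bounds {s : ℝ} (hs : 0 < s) :
    1 - Real.exp (-s) ≤ s * dickmanLaplace s ∧ s * dickmanLaplace s ≤ 1 := by
  have hi := integrable_dickman_mul_exp hs.le
  constructor
  · have h1 : expMean s ≤ dickmanLaplace s := by
      have h2 : expMean s = ∫ u in Ioc (0 : ℝ) 1, dickman u * Real.exp (-s * u) := by
        rw [expMean, intervalIntegral.integral_of_le zero_le_one]
        refine setIntegral_congr_fun measurableSet_Ioc fun u hu => ?_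
        simp only [dickman_of_le_one hu.1.le hu.2, one_mul]
      rw [h2]
      exact setIntegral_le_integral hi (Eventually.of_forall fun u =>
        mul_nonneg (dickman_nonneg u) (Real.exp_pos _).le)
    rw [expMean_eq hs.ne', div_le_iff₀ hs] at h1
    linarith
  · have h1 : dickmanLaplace s ≤ ∫ u, expDecay s u := by
      refine integral_mono hi (integrable_expDecay hs) fun u => ?_
      rcases lt_or_ge u 0 with h | h
      · simp [dickman_of_neg h, expDecay_of_neg _ h]
      · simp only [expDecay_of_nonneg _ h]
        exact mul_le_of_le_one_left (Real.exp_pos _).le (dickman_le_one u)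
    rw [integral_expDecay hs, le_div_iff₀ hs] at h1
    linarith

/-- L(0) = L(n) exp(Ein(n)) for every n > 0. As n → ∞, nL(n) → 1 and exp(Ein(n)) / n → e^γ. -/
theorem integral_dickman : ∫ u, dickman u = Real.exp Real.eulerMascheroniConstant := by
  have h0 : dickmanLaplace 0 = ∫ u, dickman u := by simp [dickmanLaplace]
  have h1 : Tendsto (fun n : ℕ => (n : ℝ) * dickmanLaplace n) atTop (𝓝 1) := by
    have h2 : Tendsto (fun n : ℕ => 1 - Real.exp (-(n : ℝ))) atTop (𝓝 1) := by
      simpa using (Real.tendsto_exp_neg_atTop_nhds_zero.comp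
        tendsto_natCast_atTop_atTop).const_sub 1
    refine tendsto_of_tendsto_of_tendsto_of_le_of_le' h2 tendsto_const_nhds ?_ ?_ <;>
    filter_upwards [eventually_gt_atTop 0] with n hn
    · exact (mul_dickmanLaplace_bounds (by exact_mod_cast hn)).1
    · exact (mul_dickmanLaplace_bounds (by exact_mod_cast hn)).2
  have h3 := h1.mul ((Real.continuous_exp.tendsto _).comp tendsto_expEin_sub_log)
  rw [one_mul] at h3
  rw [← h0]
  refine tendsto_nhds_unique (tendsto_const_nhds.congr' ?_) h3
  filter_upwards [eventually_gt_atTop 0] with n hn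
  have hn' : (0 : ℝ) < n := by exact_mod_cast hn
  rw [Function.comp, Real.exp_sub, Real.exp_log hn', ← dickmanLaplace_mul_exp_expEin hn'.le]
  field_simp

/-! ### Smooth and rough parts of integers -/

open scoped Classical in
/-- The finite set of `y`-smooth integers in `[1, t]`. -/
noncomputable def smoothUpTo (t y : ℝ) : Finset ℕ :=
  (Finset.Icc 1 ⌊t⌋₊).filter (fun n => n ∈ smooth y)

theorem mem_smoothUpTo {t y : ℝ} {n : ℕ} : n ∈ smoothUpTo t y ↔ n ∈ smooth y ∧ (n : ℝ) ≤ t := by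
  simp only [smoothUpTo, Finset.mem_filter, Finset.mem_Icc]
  constructor
  · rintro ⟨⟨h1, h2⟩, h3⟩
    exact ⟨h3, (Nat.le_floor_iff' h3.1).1 h2⟩
  · rintro ⟨h1, h2⟩
    exact ⟨⟨Nat.one_le_iff_ne_zero.2 h1.1, (Nat.le_floor_iff' h1.1).2 h2⟩, h1⟩

theorem Psi_eq_card (t y : ℝ) : Psi t y = (smoothUpTo t y).card := rfl

theorem hasSum_smooth {t y : ℝ} {f : ℕ → ℝ} (hf : ∀ n : ℕ, t < n → f n = 0) :
    HasSum (fun n : smooth y => f n) (∑ n ∈ smoothUpTo t y, f n) := by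
  change HasSum (f ∘ (↑) : smooth y → ℝ) _
  rw [hasSum_subtype_iff_indicator]
  have h : ∑ n ∈ smoothUpTo t y, f n = ∑ n ∈ smoothUpTo t y, (smooth y).indicator f n :=
    Finset.sum_congr rfl fun n hn => by rw [indicator_of_mem (mem_smoothUpTo.1 hn).1]
  rw [h]
  refine hasSum_sum_of_ne_finset_zero fun n hn => ?_
  by_cases hs : n ∈ smooth y
  · rw [indicator_of_mem hs]
    exact hf n (not_le.1 fun h => hn (mem_smoothUpTo.2 ⟨hs, h⟩))
  · rw [indicator_of_notMem hs]

theorem coprime_of_mem_smooth_of_mem_rough {y : ℝ} {n k : ℕ} (hn : n ∈ smooth y)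
    (hk : k ∈ rough y) : n.Coprime k :=
  Nat.coprime_of_dvd fun p hp h1 h2 => (hn.2 p hp h1).not_gt (hk.2 p hp h2)

theorem exists_smooth_mul_rough (y : ℝ) (m : ℕ) :
    m ≠ 0 → ∃ n ∈ smooth y, ∃ k ∈ rough y, n * k = m := by
  have h1 : ∀ p : ℕ, p.Prime → ¬ p ∣ 1 := fun p hp h => hp.one_lt.ne' (Nat.dvd_one.1 h)
  induction m using induction_on_primes with
  | zero => exact fun h => absurd rfl h
  | one =>
    exact fun _ => ⟨1, ⟨one_ne_zero, fun p hp h => absurd h (h1 p hp)⟩, 1,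
      ⟨one_ne_zero, fun p hp h => absurd h (h1 p hp)⟩, one_mul 1⟩
  | prime_mul p a hp ih =>
    intro hm
    obtain ⟨n, hn, k, hk, rfl⟩ := ih (right_ne_zero_of_mul hm)
    have hp' : p.Prime := hp
    by_cases hy : (p : ℝ) ≤ y
    · refine ⟨p * n, ⟨mul_ne_zero hp'.ne_zero hn.1, fun q hq hd => ?_⟩, k, hk, mul_assoc _ _ _⟩
      rcases hq.dvd_mul.1 hd with h | h
      · rwa [(Nat.prime_dvd_prime_iff_eq hq hp').1 h]
      · exact hn.2 q hq h
    · refine ⟨n, hn, p * k, ⟨mul_ne_zero hp'.ne_zero hk.1, fun q hq hd => ?_⟩, by ring⟩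
      rcases hq.dvd_mul.1 hd with h | h
      · rw [(Nat.prime_dvd_prime_iff_eq hq hp').1 h]; exact not_le.1 hy
      · exact hk.2 q hq h

/-- Sorting the integers up to `t` by their `y`-smooth part. -/
theorem sum_Phi_div (t y : ℝ) :
    ∑ n ∈ smoothUpTo t y, Phi (t / (n : ℕ)) y = ⌊t⌋₊ := by
  classical
  have h : ∀ n : ℕ, Phi (t / n) y =
      ((Finset.Icc 1 (⌊t⌋₊ / n)).filter (fun k => k ∈ rough y)).card := fun n => by
    rw [Phi, Nat.floor_div_natCast]
  simp_rw [h]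
  rw [← Nat.cast_sum, ← Finset.card_sigma]
  congr 1
  have hcard : ⌊t⌋₊ = (Finset.Icc 1 ⌊t⌋₊).card := by simp
  conv_rhs => rw [hcard]
  refine Finset.card_bij (fun a _ => a.1 * a.2) ?_ ?_ ?_
  · rintro ⟨n, k⟩ ha
    simp only [Finset.mem_sigma, Finset.mem_filter, Finset.mem_Icc] at ha ⊢
    obtain ⟨hn, ⟨hk1, hk2⟩, -⟩ := ha
    have hn0 : 0 < n := Nat.pos_of_ne_zero (mem_smoothUpTo.1 hn).1.1
    exact ⟨Nat.mul_pos hn0 hk1, by rw [mul_comm]; exact (Nat.le_div_iff_mul_le hn0).1 hk2⟩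
  · rintro ⟨n, k⟩ ha ⟨n', k'⟩ ha' heq
    simp only [Finset.mem_sigma, Finset.mem_filter] at ha ha' heq
    have hn := (mem_smoothUpTo.1 ha.1).1
    have hn' := (mem_smoothUpTo.1 ha'.1).1
    have h1 : n ∣ n' := (coprime_of_mem_smooth_of_mem_rough hn ha'.2.2).dvd_of_dvd_mul_right
      ⟨k, heq.symm⟩
    have h2 : n' ∣ n := (coprime_of_mem_smooth_of_mem_rough hn' ha.2.2).dvd_of_dvd_mul_right
      ⟨k', heq⟩
    obtain rfl := Nat.dvd_antisymm h1 h2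
    obtain rfl := Nat.eq_of_mul_eq_mul_left (Nat.pos_of_ne_zero hn.1) heq
    rfl
  · intro m hm
    rw [Finset.mem_Icc] at hm
    obtain ⟨n, hn, k, hk, rfl⟩ := exists_smooth_mul_rough y m (by omega)
    have hn0 : 0 < n := Nat.pos_of_ne_zero hn.1
    have hk0 : 0 < k := Nat.pos_of_ne_zero hk.1
    refine ⟨⟨n, k⟩, ?_, rfl⟩
    simp only [Finset.mem_sigma, Finset.mem_filter, Finset.mem_Icc]
    refine ⟨mem_smoothUpTo.2 ⟨hn, (Nat.le_floor_iff' hn.1).1 ?_⟩, ⟨hk0, ?_⟩, hk⟩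
    · exact (Nat.le_mul_of_pos_right n hk0).trans hm.2
    · rw [Nat.le_div_iff_mul_le hn0, mul_comm]; exact hm.2

theorem smooth_eq_smoothNumbers (y : ℝ) (hy : 0 ≤ y) :
    smooth y = Nat.smoothNumbers (⌊y⌋₊ + 1) := by
  ext n
  rw [Nat.mem_smoothNumbers']
  simp only [smooth, mem_ofPred_eq, Nat.lt_succ_iff, Nat.le_floor_iff hy]
  constructor
  · exact fun h => h.2
  · intro h
    refine ⟨?_, h⟩
    -- Zero is excluded because every prime divides it, including primes beyond y.
    rintro rfl
    obtain ⟨p, hp, hpr⟩ := Nat.exists_infinite_primes (⌊y⌋₊ + 1)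
    have := Nat.le_floor (h p hpr (dvd_zero p))
    omega

theorem primeProd_pos (y : ℝ) : 0 < primeProd y := by
  refine Finset.prod_pos fun p hp => ?_
  have h2 : (2 : ℝ) ≤ p := by exact_mod_cast (Finset.mem_filter.1 hp).2.two_le
  rw [sub_pos, div_lt_one (by linarith)]
  linarith

theorem hasSum_one_div_smooth {y : ℝ} (hy : 0 ≤ y) :
    HasSum (fun n : smooth y => 1 / ((n : ℕ) : ℝ)) (1 / primeProd y) := by
  let f : ℕ →* ℝ :=
    { toFun := fun n => 1 / (n : ℝ)
      map_one' := by simp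
      map_mul' := fun a b => by push_cast; rw [one_div_mul_one_div] }
  have hf : ∀ {p : ℕ}, p.Prime → ‖f p‖ < 1 := fun {p} hp => by
    have h2 : (2 : ℝ) ≤ p := by exact_mod_cast hp.two_le
    change ‖1 / (p : ℝ)‖ < 1
    rw [Real.norm_of_nonneg (by positivity), div_lt_one (by linarith)]
    linarith
  have h := (EulerProduct.summable_and_hasSum_smoothNumbers_prod_primesBelow_geometric hf
    (⌊y⌋₊ + 1)).2
  have hprod : ∏ p ∈ (⌊y⌋₊ + 1).primesBelow, (1 - f p)⁻¹ = 1 / primeProd y := by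
    rw [Finset.prod_inv_distrib, primeProd, one_div]
    congr 1
    refine Finset.prod_congr ?_ fun p _ => rfl
    ext p
    simp only [Nat.mem_primesBelow, Finset.mem_filter, Finset.mem_Icc]
    constructor
    · rintro ⟨h1, h2⟩; exact ⟨⟨h2.one_lt.le, by omega⟩, h2⟩
    · rintro ⟨h1, h2⟩; exact ⟨by omega, h2⟩
  rw [hprod] at h
  rw [smooth_eq_smoothNumbers y hy]
  exact h

/-! ### Normalized counting functions -/

/-- `Ψ(y^u, y) / y^u`. -/
noncomputable def psiNorm (y u : ℝ) : ℝ := Psi (y ^ u) y / y ^ u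

variable {y : ℝ}

theorem log_pos_of_two_le (hy : 2 ≤ y) : 0 < Real.log y := Real.log_pos (by linarith)

theorem rpow_lt_one_of_neg (hy : 2 ≤ y) {u : ℝ} (hu : u < 0) : y ^ u < 1 :=
  Real.rpow_lt_one_of_one_lt_of_neg (by linarith) hu

theorem natCast_le_rpow_iff (hy : 2 ≤ y) {n : ℕ} (hn : n ≠ 0) (u : ℝ) :
    (n : ℝ) ≤ y ^ u ↔ 0 ≤ u - Real.log n / Real.log y := by
  have hn' : (0 : ℝ) < n := by exact_mod_cast Nat.pos_of_ne_zero hn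
  rw [Real.le_rpow_iff_log_le hn' (by linarith), sub_nonneg, div_le_iff₀ (log_pos_of_two_le hy)]

/-- Exhibits ψ as a superposition of translated exponentials, one for each smooth n starting at log
n / log y with weight 1/n. -/
theorem one_div_mul_expDecay (hy : 2 ≤ y) {n : ℕ} (hn : n ≠ 0) (u : ℝ) :
    1 / (n : ℝ) * expDecay (Real.log y) (u - Real.log n / Real.log y) =
      if (n : ℝ) ≤ y ^ u then 1 / y ^ u else 0 := by
  have hn' : (0 : ℝ) < n := by exact_mod_cast Nat.pos_of_ne_zero hn
  have hL := log_pos_of_two_le hy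
  split_ifs with h
  · rw [expDecay_of_nonneg _ ((natCast_le_rpow_iff hy hn u).1 h),
      Real.rpow_def_of_pos (by linarith : 0 < y)]
    have : -Real.log y * (u - Real.log n / Real.log y) = Real.log n - Real.log y * u := by
      field_simp
      ring
    rw [this, Real.exp_sub, Real.exp_log hn']
    field_simp
  · rw [expDecay_of_neg _ (not_le.1 fun h' => h ((natCast_le_rpow_iff hy hn u).2 h')), mul_zero]

/-- The index set depends on a only, so the finite sum can be taken out of integrals over u ≤ a. -/
theorem psiNorm_eq_sum (hy : 2 ≤ y) {u a : ℝ} (hu : u ≤ a) : psiNorm y u =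
    ∑ n ∈ smoothUpTo (y ^ a) y,
      1 / (n : ℝ) * expDecay (Real.log y) (u - Real.log n / Real.log y) := by
  have hle : y ^ u ≤ y ^ a := Real.rpow_le_rpow_of_exponent_le (by linarith) hu
  have hsub : smoothUpTo (y ^ u) y ⊆ smoothUpTo (y ^ a) y := fun n hn =>
    mem_smoothUpTo.2 ⟨(mem_smoothUpTo.1 hn).1, (mem_smoothUpTo.1 hn).2.trans hle⟩
  rw [← Finset.sum_subset hsub fun n hn hn' => ?_]
  · have : ∀ n ∈ smoothUpTo (y ^ u) y,
        1 / (n : ℝ) * expDecay (Real.log y) (u - Real.log n / Real.log y) = 1 / y ^ u :=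
      fun n hn => by
        rw [one_div_mul_expDecay hy (mem_smoothUpTo.1 hn).1.1, if_pos (mem_smoothUpTo.1 hn).2]
    rw [Finset.sum_congr rfl this, Finset.sum_const, nsmul_eq_mul, psiNorm, Psi_eq_card,
      mul_one_div]
  · have hs := (mem_smoothUpTo.1 hn).1
    rw [one_div_mul_expDecay hy hs.1, if_neg fun h => hn' (mem_smoothUpTo.2 ⟨hs, h⟩)]

theorem hasSum_psiNorm (hy : 2 ≤ y) (u : ℝ) :
    HasSum (fun n : smooth y =>
      1 / ((n : ℕ) : ℝ) * expDecay (Real.log y) (u - Real.log (n : ℕ) / Real.log y))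
      (psiNorm y u) := by
  rw [psiNorm_eq_sum hy le_rfl]
  refine hasSum_smooth (f := fun n : ℕ =>
    1 / (n : ℝ) * expDecay (Real.log y) (u - Real.log n / Real.log y)) fun n hn => ?_
  rcases eq_or_ne n 0 with rfl | h0
  · simp
  · rw [one_div_mul_expDecay hy h0, if_neg hn.not_ge]

theorem causal_psiNorm (hy : 2 ≤ y) : Causal (psiNorm y) := by
  have hy0 : 0 < y := by linarith
  refine ⟨?_, fun u hu => ?_, fun a => ⟨1, fun u _ => ?_⟩⟩
  · have hm : Measurable fun u : ℝ => y ^ u := by fun_prop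
    have h1 : Measurable fun u : ℝ => Psi (y ^ u) y := by
      have : (fun u : ℝ => Psi (y ^ u) y) = (fun N : ℕ => Psi N y) ∘ fun u => ⌊y ^ u⌋₊ := by
        ext u
        simp only [Function.comp, Psi, Nat.floor_natCast]
      rw [this]
      exact (measurable_of_countable _).comp (Nat.measurable_floor.comp hm)
    exact h1.div hm
  · rw [psiNorm, Psi, Nat.floor_eq_zero.2 (rpow_lt_one_of_neg hy hu)]
    simp
  · have hpos : 0 < y ^ u := Real.rpow_pos_of_pos hy0 u
    have h1 : Psi (y ^ u) y ≤ y ^ u := by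
      refine le_trans ?_ (Nat.floor_le hpos.le)
      rw [Psi]
      classical
      exact Nat.cast_le.2 ((Finset.card_filter_le _ _).trans (by simp))
    have h0 : 0 ≤ Psi (y ^ u) y := Nat.cast_nonneg _
    rw [psiNorm, abs_of_nonneg (by positivity)]
    exact (div_le_one hpos).2 h1

/-- Each translated exponential has mass 1 / log y; the weights 1/n sum to 1 / Π(y) by the Euler
product. -/
theorem integral_psiNorm (hy : 2 ≤ y) :
    ∫ u, psiNorm y u = 1 / (Real.log y * primeProd y) := by
  have hL := log_pos_of_two_le hy
  have hsum := hasSum_one_div_smooth (by linarith : 0 ≤ y)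
  have hint : ∀ a, Integrable fun u => expDecay (Real.log y) (u - a) := fun a =>
    (integrable_expDecay hL).comp_sub_right a
  have hval : ∀ n : smooth y, ∫ u, 1 / ((n : ℕ) : ℝ) *
      expDecay (Real.log y) (u - Real.log (n : ℕ) / Real.log y) =
      1 / ((n : ℕ) : ℝ) * (1 / Real.log y) := fun n => by
    rw [integral_const_mul, integral_sub_right_eq_self (expDecay (Real.log y)), integral_expDecay hL]
  have h := hasSum_integral_of_summable_integral_norm (μ := volume)
    (F := fun (n : smooth y) u =>
      1 / ((n : ℕ) : ℝ) * expDecay (Real.log y) (u - Real.log (n : ℕ) / Real.log y))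
    (fun n => (hint _).const_mul _) ?_
  · simp only [hval, (hasSum_psiNorm hy _).tsum_eq] at h
    rw [h.unique (hsum.mul_right _), one_div_mul_one_div, mul_comm]
  · have : ∀ (n : smooth y) u,
        ‖1 / ((n : ℕ) : ℝ) * expDecay (Real.log y) (u - Real.log (n : ℕ) / Real.log y)‖ =
          1 / ((n : ℕ) : ℝ) * expDecay (Real.log y) (u - Real.log (n : ℕ) / Real.log y) :=
      fun n u => Real.norm_of_nonneg (mul_nonneg (by positivity) (expDecay_nonneg _ _))
    simp only [this, hval]
    exact hsum.summable.mul_right _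

theorem integrable_psiNorm (hy : 2 ≤ y) : Integrable (psiNorm y) := by
  -- A nonintegrable function has integral 0 by convention, whereas this integral is positive.
  by_contra h
  have h1 := integral_psiNorm hy
  rw [integral_undef h] at h1
  exact (one_div_pos.2 (mul_pos (log_pos_of_two_le hy) (primeProd_pos y))).ne h1

theorem muFun_eq_conv (hy : 2 ≤ y) (u : ℝ) :
    muFun y u = conv (expDecay (Real.log y)) buchstab u := by
  have hL := log_pos_of_two_le hy
  have he := causal_expDecay hL
  rcases lt_or_ge u 0 with h | h
  · rw [(he.conv causal_buchstab).zero u h, muFun, intervalIntegral.integral_symm,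
      intervalIntegral.integral_of_le h.le, setIntegral_eq_zero_of_forall_eq_zero, neg_zero]
    intro v hv
    rw [buchstab_of_lt_one (by linarith [hv.1]), zero_mul]
  · rw [he.conv_eq_intervalIntegral causal_buchstab h, muFun]
    refine intervalIntegral.integral_congr fun v hv => ?_
    rw [uIcc_of_le h] at hv
    simp only [expDecay_of_nonneg _ hv.1]
    rw [Real.rpow_def_of_pos (by linarith : 0 < y)]
    ring_nf

theorem Phi_of_lt_one {t : ℝ} (ht : t < 1) (y : ℝ) : Phi t y = 0 := by
  rw [Phi, Nat.floor_eq_zero.2 ht]; simp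

theorem QStar_of_lt_one (hy : 2 ≤ y) {t : ℝ} (ht0 : 0 < t) (ht : t < 1) : QStar t y = 0 := by
  rw [QStar, VStar, Phi_of_lt_one ht, if_neg ht.not_ge, muFun_eq_conv hy,
    ((causal_expDecay (log_pos_of_two_le hy)).conv causal_buchstab).zero _
      (div_neg_of_neg_of_pos (Real.log_neg ht0 ht) (log_pos_of_two_le hy))]
  simp

theorem hasSum_QStar (hy : 2 ≤ y) {t : ℝ} (ht : 0 < t) :
    HasSum (fun n : smooth y => QStar (t / ((n : ℕ) : ℝ)) y)
      (∑ n ∈ smoothUpTo t y, QStar (t / (n : ℝ)) y) :=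
  hasSum_smooth (f := fun n : ℕ => QStar (t / (n : ℝ)) y) fun _ hn =>
    QStar_of_lt_one hy (div_pos ht (ht.trans hn)) ((div_lt_one (ht.trans hn)).2 hn)

/-- Q - Q* is linear in its first argument, so the difference sums to a multiple of ∑ 1/n = 1 /
Π(y). The Q* part is a finite sum. -/
theorem hasSum_Q (hy : 2 ≤ y) {t : ℝ} (ht : 0 < t) :
    HasSum (fun n : smooth y => Q (t / ((n : ℕ) : ℝ)) y)
      (RStar t y + t * (1 - Real.exp (-Real.eulerMascheroniConstant) /
        (Real.log y * primeProd y))) := by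
  have h1 := (hasSum_QStar hy ht).summable.hasSum
  have hP := primeProd_pos y
  have hL := log_pos_of_two_le hy
  have h2 := (hasSum_one_div_smooth (by linarith : 0 ≤ y)).mul_left
    (t * (primeProd y - Real.exp (-Real.eulerMascheroniConstant) / Real.log y))
  convert! h1.add h2 using 1
  · ext n
    simp only [Q, QStar, V, VStar]
    ring
  · rw [RStar]
    field_simp

theorem R_eq (hy : 2 ≤ y) {t : ℝ} (ht : 0 < t) :
    R t y = RStar t y + t * (1 - Real.exp (-Real.eulerMascheroniConstant) /
        (Real.log y * primeProd y)) :=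
  (hasSum_Q hy ht).tsum_eq

theorem psiNorm_conv_buchstab (hy : 2 ≤ y) (u : ℝ) : conv (psiNorm y) buchstab u =
    ∑ n ∈ smoothUpTo (y ^ u) y, 1 / (n : ℝ) * muFun y (u - Real.log n / Real.log y) := by
  have he := causal_expDecay (log_pos_of_two_le hy)
  have h1 : ∀ v, psiNorm y v * buchstab (u - v) = ∑ n ∈ smoothUpTo (y ^ u) y,
      1 / (n : ℝ) * (expDecay (Real.log y) (v - Real.log n / Real.log y) * buchstab (u - v)) :=
    fun v => by
      rcases le_or_gt v u with h | h
      · rw [psiNorm_eq_sum hy h, Finset.sum_mul]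
        simp only [mul_assoc]
      · simp [buchstab_of_lt_one (by linarith : u - v < 1)]
  rw [conv_apply]
  simp_rw [h1]
  rw [integral_finsetSum]
  · refine Finset.sum_congr rfl fun _ _ => ?_
    rw [integral_const_mul, muFun_eq_conv hy, ← shift_conv]
    rfl
  · intro n _
    have h0 : 0 ≤ Real.log n / Real.log y :=
      div_nonneg (Real.log_natCast_nonneg n) (log_pos_of_two_le hy).le
    exact ((he.shift h0).integrable causal_buchstab u).const_mul _

/-- `R*(y^u, y) / y^u`. -/
noncomputable def rStarNorm (y u : ℝ) : ℝ := RStar (y ^ u) y / y ^ u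

/-- The three terms of Q* give respectively the count of smooth n, the convolution with ω, and the
count of all integers up to y^u sorted by smooth part. -/
theorem rStarNorm_eq (hy : 2 ≤ y) (u : ℝ) : rStarNorm y u =
    psiNorm y u + conv (psiNorm y) buchstab u - ⌊y ^ u⌋₊ / y ^ u := by
  have hy0 : 0 < y := by linarith
  have hpos : 0 < y ^ u := Real.rpow_pos_of_pos hy0 u
  have hL := log_pos_of_two_le hy
  have h1 : ∀ n ∈ smoothUpTo (y ^ u) y, QStar (y ^ u / (n : ℝ)) y =
      1 + y ^ u * (1 / (n : ℝ) * muFun y (u - Real.log n / Real.log y)) -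
        Phi (y ^ u / (n : ℝ)) y := fun n hn => by
    obtain ⟨hs, hle⟩ := mem_smoothUpTo.1 hn
    have hn' : (0 : ℝ) < n := by exact_mod_cast Nat.pos_of_ne_zero hs.1
    have hlog : Real.log (y ^ u / n) / Real.log y = u - Real.log n / Real.log y := by
      rw [Real.log_div hpos.ne' hn'.ne', Real.log_rpow hy0]
      field_simp
    rw [QStar, VStar, if_pos ((one_le_div hn').2 hle), hlog]
    ring
  rw [rStarNorm, RStar, (hasSum_QStar hy hpos).tsum_eq, Finset.sum_congr rfl h1,
    Finset.sum_sub_distrib, Finset.sum_add_distrib, sum_Phi_div, ← Finset.mul_sum,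
    ← psiNorm_conv_buchstab hy, psiNorm, Psi_eq_card]
  simp only [Finset.sum_const, nsmul_eq_mul, mul_one]
  field_simp

/-! ### The error terms on the logarithmic scale -/

/-- `{y^u} / y^u` for `u ≥ 0`, extended by zero. -/
noncomputable def fractNorm (y : ℝ) : ℝ → ℝ :=
  (Ici (0 : ℝ)).indicator fun u => Int.fract (y ^ u) / y ^ u

theorem fractNorm_of_nonneg (y : ℝ) {u : ℝ} (hu : 0 ≤ u) :
    fractNorm y u = Int.fract (y ^ u) / y ^ u := by simp [fractNorm, hu]

theorem fractNorm_of_neg (y : ℝ) {u : ℝ} (hu : u < 0) : fractNorm y u = 0 := by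
  simp [fractNorm, hu]

theorem measurable_fractNorm (y : ℝ) : Measurable (fractNorm y) := by
  have hm : Measurable fun u : ℝ => y ^ u := by fun_prop
  exact (hm.fract.div hm).indicator measurableSet_Ici

theorem abs_fractNorm_le (hy : 2 ≤ y) (u : ℝ) :
    |fractNorm y u| ≤ 1 * expDecay (Real.log y) u := by
  rcases lt_or_ge u 0 with h | h
  · simp [fractNorm_of_neg y h, expDecay_of_neg _ h]
  · have hpos : 0 < y ^ u := Real.rpow_pos_of_pos (by linarith) u
    rw [fractNorm_of_nonneg y h, expDecay_of_nonneg _ h, one_mul,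
      abs_of_nonneg (div_nonneg (Int.fract_nonneg _) hpos.le), neg_mul, Real.exp_neg,
      ← Real.rpow_def_of_pos (by linarith : 0 < y), div_eq_mul_inv]
    exact mul_le_of_le_one_left (inv_pos.2 hpos).le (Int.fract_lt_one _).le

theorem causal_fractNorm (hy : 2 ≤ y) : Causal (fractNorm y) := by
  refine ⟨measurable_fractNorm y, fun u hu => fractNorm_of_neg y hu, fun a => ?_⟩
  obtain ⟨C, hC⟩ := (causal_expDecay (log_pos_of_two_le hy)).bdd a
  exact ⟨C, fun u hu => (abs_fractNorm_le hy u).trans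
    (by rw [one_mul]; exact (le_abs_self _).trans (hC u hu))⟩

theorem integrable_fractNorm (hy : 2 ≤ y) : Integrable (fractNorm y) :=
  integrable_of_le_expDecay (measurable_fractNorm y) (log_pos_of_two_le hy) (abs_fractNorm_le hy)

/-- `Λ(y^u, y) / y^u` for `u ≥ 0`, extended by zero. -/
noncomputable def lamNorm (y : ℝ) : ℝ → ℝ :=
  dickman - fractNorm y - conv (fractNorm y) dickmanDeriv

theorem Lam_rpow_div (hy : 2 ≤ y) {u : ℝ} (hu : 0 ≤ u) : Lam (y ^ u) y / y ^ u = lamNorm y u := by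
  have hy0 : 0 < y := by linarith
  have hpos : 0 < y ^ u := Real.rpow_pos_of_pos hy0 u
  have hlog : Real.log (y ^ u) / Real.log y = u := by
    rw [Real.log_rpow hy0, mul_div_cancel_right₀ _ (log_pos_of_two_le hy).ne']
  have hint : ∫ v in (0 : ℝ)..u, dickmanDeriv (u - v) * (Int.fract (y ^ v) / y ^ v) =
      conv (fractNorm y) dickmanDeriv u := by
    rw [(causal_fractNorm hy).conv_eq_intervalIntegral causal_dickmanDeriv hu]
    refine intervalIntegral.integral_congr fun v hv => ?_
    rw [uIcc_of_le hu] at hv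
    simp only [fractNorm_of_nonneg y hv.1, mul_comm]
  rw [Lam, hlog, hint, lamNorm, Pi.sub_apply, Pi.sub_apply, fractNorm_of_nonneg y hu]
  field_simp

theorem causal_lamNorm (hy : 2 ≤ y) : Causal (lamNorm y) :=
  (causal_dickman.sub (causal_fractNorm hy)).sub ((causal_fractNorm hy).conv causal_dickmanDeriv)

/-- `Δ(y^u, y) / y^u` for `u ≥ 0`, extended by zero. -/
noncomputable def deltaNorm (y : ℝ) : ℝ → ℝ := psiNorm y - lamNorm y

theorem causal_deltaNorm (hy : 2 ≤ y) : Causal (deltaNorm y) :=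
  (causal_psiNorm hy).sub (causal_lamNorm hy)

theorem Delta_rpow_div (hy : 2 ≤ y) {u : ℝ} (hu : 0 ≤ u) :
    Delta (y ^ u) y / y ^ u = deltaNorm y u := by
  rw [Delta, sub_div, Lam_rpow_div hy hu]
  rfl

theorem integrable_conv {f g : ℝ → ℝ} (hf : Integrable f) (hg : Integrable g) :
    Integrable (conv f g) :=
  hf.integrable_convolution (ContinuousLinearMap.mul ℝ ℝ) hg

theorem integrable_lamNorm (hy : 2 ≤ y) : Integrable (lamNorm y) :=
  (integrable_dickman.sub (integrable_fractNorm hy)).sub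
    (integrable_conv (integrable_fractNorm hy) integrable_dickmanDeriv)

/-- The two fractional-part terms cancel because ∫ρ' = -1, leaving ∫ρ. -/
theorem integral_lamNorm (hy : 2 ≤ y) :
    ∫ u, lamNorm y u = Real.exp Real.eulerMascheroniConstant := by
  have hf := integrable_fractNorm hy
  rw [lamNorm, integral_sub' (integrable_dickman.sub hf)
    (integrable_conv hf integrable_dickmanDeriv), integral_sub' integrable_dickman hf,
    integral_conv hf integrable_dickmanDeriv, integral_dickmanDeriv_univ, integral_dickman]
  ring

theorem integrable_deltaNorm (hy : 2 ≤ y) : Integrable (deltaNorm y) :=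
  (integrable_psiNorm hy).sub (integrable_lamNorm hy)

theorem integral_deltaNorm (hy : 2 ≤ y) : ∫ u, deltaNorm y u =
    1 / (Real.log y * primeProd y) - Real.exp Real.eulerMascheroniConstant := by
  rw [deltaNorm, integral_sub' (integrable_psiNorm hy) (integrable_lamNorm hy),
    integral_psiNorm hy, integral_lamNorm hy]

/-- Here λ = (δ + ρ') * (H - f), and convolution with δ + ω removes the first factor. -/
theorem lamNorm_add_conv_buchstab (hy : 2 ≤ y) :
    lamNorm y + conv (lamNorm y) buchstab = heaviside - fractNorm y := by
  have hf := causal_fractNorm hy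
  have hr := causal_dickmanDeriv
  have hw := causal_buchstab
  have h : conv (lamNorm y) buchstab = conv dickman buchstab + -conv (fractNorm y) buchstab +
      -conv (conv (fractNorm y) dickmanDeriv) buchstab := by
    rw [lamNorm, sub_eq_add_neg, sub_eq_add_neg,
      (causal_dickman.add hf.neg).add_conv (hf.conv hr).neg hw,
      causal_dickman.add_conv hf.neg hw, neg_conv, neg_conv]
  rw [h, dickman_conv_buchstab, hf.conv_assoc hr hw, dickmanDeriv_conv_buchstab, conv_neg,
    hf.conv_add hr hw, lamNorm]
  abel

/-- ⌊y^u⌋ / y^u = H - f = (δ + ω) * λ, so subtracting it from (δ + ω) * ψ leaves (δ + ω) * d. -/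
theorem rStarNorm_eq_deltaNorm_add (hy : 2 ≤ y) :
    rStarNorm y = deltaNorm y + conv (deltaNorm y) buchstab := by
  have hw := causal_buchstab
  ext u
  have h1 : conv (deltaNorm y) buchstab =
      conv (psiNorm y) buchstab + -conv (lamNorm y) buchstab := by
    rw [deltaNorm, sub_eq_add_neg, (causal_psiNorm hy).add_conv (causal_lamNorm hy).neg hw, neg_conv]
  have h2 := congrFun (lamNorm_add_conv_buchstab hy) u
  have h3 : (⌊y ^ u⌋₊ : ℝ) / y ^ u = heaviside u - fractNorm y u := by
    rcases lt_or_ge u 0 with h | h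
    · rw [Nat.floor_eq_zero.2 (rpow_lt_one_of_neg hy h), heaviside_of_neg h, fractNorm_of_neg y h]
      simp
    · have hpos : 0 < y ^ u := Real.rpow_pos_of_pos (by linarith) u
      rw [heaviside_of_nonneg h, fractNorm_of_nonneg y h, Int.fract,
        ← natCast_floor_eq_intCast_floor hpos.le]
      field_simp
      ring
  rw [rStarNorm_eq hy, h3, h1]
  simp only [deltaNorm, Pi.add_apply, Pi.sub_apply, Pi.neg_apply] at h2 ⊢
  linear_combination h2

theorem causal_rStarNorm (hy : 2 ≤ y) : Causal (rStarNorm y) := by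
  rw [rStarNorm_eq_deltaNorm_add hy]
  exact (causal_deltaNorm hy).add ((causal_deltaNorm hy).conv causal_buchstab)

theorem deltaNorm_eq_rStarNorm_add (hy : 2 ≤ y) :
    deltaNorm y = rStarNorm y + conv (rStarNorm y) dickmanDeriv := by
  have hd := causal_deltaNorm hy
  have hr := causal_dickmanDeriv
  have hw := causal_buchstab
  rw [rStarNorm_eq_deltaNorm_add hy, hd.add_conv (hd.conv hw) hr, hd.conv_assoc hw hr,
    conv_comm buchstab, dickmanDeriv_conv_buchstab, conv_neg, hd.conv_add hr hw]
  abel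

/-- A convolution integral of causal functions over `[0, u]`, with the first factor known only on
the nonnegative axis. -/
theorem Causal.intervalIntegral_eq_conv {f g F : ℝ → ℝ} (hf : Causal f) (hg : Causal g) {u : ℝ}
    (hu : 0 ≤ u) (h : ∀ v, 0 ≤ v → F v = f v) :
    IntervalIntegrable (fun v => F v * g (u - v)) volume 0 u ∧
      ∫ v in (0 : ℝ)..u, F v * g (u - v) = SmoothRough.conv f g u := by
  constructor
  · refine (hf.integrable hg u).intervalIntegrable.congr fun v hv => ?_
    rw [uIoc_of_le hu] at hv
    simp only [h v hv.1.le]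
  · rw [hf.conv_eq_intervalIntegral hg hu]
    refine intervalIntegral.integral_congr fun v hv => ?_
    rw [uIcc_of_le hu] at hv
    simp only [h v hv.1]

/-- R(y^v) / y^v is the causal r plus a constant that persists for v < 0; integrated over the full
half-line against ρ', of total mass -1, the constant returns with opposite sign. -/
theorem integral_R_mul_dickmanDeriv (hy : 2 ≤ y) (u : ℝ) :
    IntegrableOn (fun v => R (y ^ v) y / y ^ v * dickmanDeriv (u - v)) (Iic u) ∧
      ∫ v in Iic u, R (y ^ v) y / y ^ v * dickmanDeriv (u - v) =
        conv (rStarNorm y) dickmanDeriv u -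
          (1 - Real.exp (-Real.eulerMascheroniConstant) / (Real.log y * primeProd y)) := by
  set c := 1 - Real.exp (-Real.eulerMascheroniConstant) / (Real.log y * primeProd y) with hc
  have heq : (fun v => R (y ^ v) y / y ^ v * dickmanDeriv (u - v)) =
      fun v => rStarNorm y v * dickmanDeriv (u - v) + c * dickmanDeriv (u - v) := by
    ext v
    have hpos : 0 < y ^ v := Real.rpow_pos_of_pos (by linarith) v
    rw [R_eq hy hpos, add_div, mul_div_cancel_left₀ _ hpos.ne', ← hc, add_mul]
    rfl
  have h1 := (causal_rStarNorm hy).integrable causal_dickmanDeriv u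
  have h2 : Integrable fun v => c * dickmanDeriv (u - v) :=
    (integrable_dickmanDeriv.comp_sub_left u).const_mul c
  rw [heq]
  refine ⟨(h1.add h2).integrableOn, ?_⟩
  rw [setIntegral_eq_integral_of_forall_compl_eq_zero, integral_add h1 h2, integral_const_mul,
    integral_sub_left_eq_self dickmanDeriv, integral_dickmanDeriv_univ, conv_apply]
  · ring
  · intro v hv
    rw [mem_Iic, not_le] at hv
    rw [dickmanDeriv_of_lt_one (by linarith)]
    ring

theorem integral_Delta_mul_buchstab_sub (hy : 2 ≤ y) (u c : ℝ) :
    IntegrableOn (fun v => Delta (y ^ v) y / y ^ v * (buchstab (u - v) - c)) (Ioi 0) ∧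
      ∫ v in Ioi (0 : ℝ), Delta (y ^ v) y / y ^ v * (buchstab (u - v) - c) =
        conv (deltaNorm y) buchstab u - c * ∫ v, deltaNorm y v := by
  have hd := causal_deltaNorm hy
  have heq : EqOn (fun v => deltaNorm y v * (buchstab (u - v) - c))
      (fun v => Delta (y ^ v) y / y ^ v * (buchstab (u - v) - c)) (Ioi 0) := fun v hv => by
    simp only [Delta_rpow_div hy (le_of_lt hv)]
  have h1 := hd.integrable causal_buchstab u
  have h2 := (integrable_deltaNorm hy).const_mul c
  have hsplit : (fun v => deltaNorm y v * (buchstab (u - v) - c)) =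
      fun v => deltaNorm y v * buchstab (u - v) - c * deltaNorm y v := by
    ext v; ring
  constructor
  · refine IntegrableOn.congr_fun ?_ heq measurableSet_Ioi
    rw [hsplit]
    exact (h1.sub h2).integrableOn
  · rw [← setIntegral_congr_fun measurableSet_Ioi heq, hd.integral_Ioi, hsplit,
      integral_sub h1 h2, integral_const_mul, conv_apply]

end SmoothRough

/-! ### The four identities -/

theorem theorem1 (x y : ℝ) (hx : 1 ≤ x) (hy : 2 ≤ y) :
    -- the series that define `R(t, y)` and `R*(t, y)` converge absolutely
    (∀ t : ℝ, 0 < t → Summable (fun n : smooth y => Q (t / ((n : ℕ) : ℝ)) y)) ∧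
    (∀ t : ℝ, 0 < t → Summable (fun n : smooth y => QStar (t / ((n : ℕ) : ℝ)) y)) ∧
    -- first identity
    (IntegrableOn
        (fun v : ℝ => R (y ^ v) y / y ^ v * dickmanDeriv (Real.log x / Real.log y - v))
        (Set.Iic (Real.log x / Real.log y)) volume ∧
      Delta x y = R x y + x * ∫ v in Set.Iic (Real.log x / Real.log y),
        R (y ^ v) y / y ^ v * dickmanDeriv (Real.log x / Real.log y - v)) ∧
    -- second identity
    (IntervalIntegrable
        (fun v : ℝ => RStar (y ^ v) y / y ^ v * dickmanDeriv (Real.log x / Real.log y - v))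
        volume 0 (Real.log x / Real.log y) ∧
      Delta x y = RStar x y + x * ∫ v in (0 : ℝ)..(Real.log x / Real.log y),
        RStar (y ^ v) y / y ^ v * dickmanDeriv (Real.log x / Real.log y - v)) ∧
    -- third identity
    (IntegrableOn
        (fun v : ℝ => Delta (y ^ v) y / y ^ v *
          (buchstab (Real.log x / Real.log y - v) - Real.exp (-Real.eulerMascheroniConstant)))
        (Set.Ioi 0) volume ∧
      R x y = Delta x y + x * ∫ v in Set.Ioi (0 : ℝ),
        Delta (y ^ v) y / y ^ v *
          (buchstab (Real.log x / Real.log y - v) - Real.exp (-Real.eulerMascheroniConstant))) ∧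
    -- fourth identity
    (IntervalIntegrable
        (fun v : ℝ => Delta (y ^ v) y / y ^ v * buchstab (Real.log x / Real.log y - v))
        volume 0 (Real.log x / Real.log y) ∧
      RStar x y = Delta x y + x * ∫ v in (0 : ℝ)..(Real.log x / Real.log y),
        Delta (y ^ v) y / y ^ v * buchstab (Real.log x / Real.log y - v)) := by
  have hy0 : 0 < y := by linarith
  have hL := log_pos_of_two_le hy
  have hP := primeProd_pos y
  have hxpos : 0 < x := by linarith
  obtain ⟨u, hu⟩ : ∃ u, Real.log x / Real.log y = u := ⟨_, rfl⟩
  have hu0 : 0 ≤ u := hu ▸ div_nonneg (Real.log_nonneg hx) hL.le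
  have hxu : x = y ^ u := by
    rw [Real.rpow_def_of_pos hy0, ← hu, mul_div_cancel₀ _ hL.ne', Real.exp_log hxpos]
  rw [hu]
  have hD : Delta x y = x * deltaNorm y u := by
    rw [← Delta_rpow_div hy hu0, ← hxu, mul_div_cancel₀ _ hxpos.ne']
  have hRS : RStar x y = x * rStarNorm y u := by
    rw [rStarNorm, ← hxu, mul_div_cancel₀ _ hxpos.ne']
  have hR := R_eq hy hxpos
  have e2 := congrFun (deltaNorm_eq_rStarNorm_add hy) u
  have e4 := congrFun (rStarNorm_eq_deltaNorm_add hy) u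
  rw [Pi.add_apply] at e2 e4
  obtain ⟨i1, j1⟩ := integral_R_mul_dickmanDeriv hy u
  obtain ⟨i2, j2⟩ := (causal_rStarNorm hy).intervalIntegral_eq_conv causal_dickmanDeriv
    (F := fun v => RStar (y ^ v) y / y ^ v) hu0 fun v _ => rfl
  obtain ⟨i3, j3⟩ := integral_Delta_mul_buchstab_sub hy u
    (Real.exp (-Real.eulerMascheroniConstant))
  obtain ⟨i4, j4⟩ := (causal_deltaNorm hy).intervalIntegral_eq_conv causal_buchstab
    (F := fun v => Delta (y ^ v) y / y ^ v) hu0 fun v hv => Delta_rpow_div hy hv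
  refine ⟨fun t ht => (hasSum_Q hy ht).summable, fun t ht => (hasSum_QStar hy ht).summable,
    ⟨i1, ?_⟩, ⟨i2, ?_⟩, ⟨i3, ?_⟩, ⟨i4, ?_⟩⟩
  · rw [j1, hR, hD, hRS]
    linear_combination x * e2
  · rw [j2, hD, hRS]
    linear_combination x * e2
  -- This makes -e^{-γ} ∫d equal to 1 - e^{-γ} / (Π(y) log y), the constant separating R from R*.
  · have hE : Real.exp (-Real.eulerMascheroniConstant) * Real.exp Real.eulerMascheroniConstant =
        1 := by
      rw [← Real.exp_add]; simp
    rw [j3, integral_deltaNorm hy, hR, hD, hRS]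
    linear_combination x * e4 - x * hE
  · rw [j4, hD, hRS]
    linear_combination x * e4
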